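/- **Model.** Peers are labelled by natural numbers and the source is peer $1$. There are $M=2$ layers; each is at any time a 1-regular digraph (a permutation) on the current finite set $V$ of peers, and $p_m(v)$, $c_m(v)$ denote the parent and the child of $v$ in layer $m$. Initially $V=\{1\}$ and both layers consist of a loop. When a new peer $v$ joins, $V$ becomes $V\cup\{v\}$ and $w_1,w_2$ are chosen independently and uniformly from the new $V$; for each $m$, if $w_m=v$ then $v$ creates a loop in layer $m$, and otherwise the edge $(w_m,c_m(w_m))$ is replaced by $(w_m,v)$ and $(v,c_m(w_m))$. When a peer $v\neq 1$ leaves, $(p_m(v),v)$ and $(v,c_m(v))$ are replaced by $(p_m(v),c_m(v))$ for each $m$. Consider the network after any fixed finite sequence of joins and leaves, and let $N=|V|$. Fix $0<c<1$ and let $d^*=\lceil \log_2 (N/\log^c N)\rceil$. Each peer $v$ computes a depth $d(v)$ and a main flow $\chi(v)$ by the random flow-assignment algorithm. The source has $d=0$ and $\chi=0$. If the source is the $m^*$-th parent of $v\ne 1$, then $d(v)=1$ and $\chi(v)=m^*$. Otherwise, if $v$ has a parent of depth less than $d^*$, then $d(v)=d(p_{m^*}(v))+1$ and $\chi(v)=\chi(p_{m^*}(v))$,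 where $p_{m^*}(v)$ is the parent of smallest depth. Otherwise $d(v)=\infty$ and $\chi(v)=0$. Ties in the choice of $m^*$ are broken by independent fair coins, one for each peer, independent of the layers. The initial values are $d(v)=\infty$, $\chi(v)=0$ for $v\neq 1$, and the algorithm is rerun until no value changes. Let $N_d=|\{v\in V: d(v)=d\}|$, let $N_{>d-1}=N-\sum_{h<d}N_h$, and let $X_d=|\{v\in V: d(v)=d,\ \chi(v)=1\}|$ be the number of flow-1 peers in depth $d$. Put $d_1=\lceil \tfrac13\log_2 N\rceil$, $d_2=\lceil \tfrac56\log_2 N\rceil$, and $$\phi_d=\begin{cases}1 & 0\le d<d_1,\\ 1-N^{-1/9} & d_1\le d<d_2,\\ \left(1-\dfrac{N_d}{N_{>d-1}}\right)^3 & d\ge d_2.\end{cases}$$ **Proposition 4.** For every $\epsilon>0$ there is an $N_0$, depending only on $c$ and $\epsilon$, such that, whenever $N\ge N_0$, the event that $N_d\ge 2\phi_{d-1}N_{d-1}$ for all $1\le d\le d^*$ has positive probability and, conditioned on it, $$\Pr\left\{\left|\frac{X_d}{N_d}-\frac12\right|<\epsilon\ \text{ for all } 1\le d\le d^*\right\}\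 \ge\ 1-\frac{2\log_2 N}{\exp\left(\dfrac{(1-\epsilon)N^{1/3}}{4\log_2^4 N}\right)}.$$ The same bound holds conditioned on any realization $(N_0,\dots,N_{d^*})=(n_0,\dots,n_{d^*})$ of positive probability that satisfies these inequalities. -/

import Mathlib

namespace P2P

open Equiv

/-- Peers carry labels in `ℕ`; the source is peer `1`. -/
def source : ℕ := 1

/-- The two layers of the network. A 1-regular digraph on a finite set `V` of peers is a
permutation of `V`; it is represented by the permutation of all labels that fixes every label
outside `V`. The `m`-th child of `v` is `c m v`, the `m`-th parent of `v` is `(c m).symm v`. -/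
abbrev Layers : Type := Fin 2 → Perm ℕ

/-- The new peer `v` breaks into the outgoing edge `(w, w')` of `w`, which is replaced by
`(w, v)` and `(v, w')`; if `w = v`, then `v` creates a loop. (Before the call, `v` is fixed.) -/
def joinLayer (c : Perm ℕ) (v w : ℕ) : Perm ℕ := c * swap w v

/-- The peer `v` leaves: its edges `(p, v)` and `(v, c v)` are replaced by `(p, c v)`. -/
def leaveLayer (c : Perm ℕ) (v : ℕ) : Perm ℕ := swap v (c v) * c

theorem joinLayer_apply_new {c : Perm ℕ} {v w : ℕ} : joinLayer c v w v = c w := by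
  simp [joinLayer]

theorem joinLayer_apply_old {c : Perm ℕ} {v w : ℕ} (h : c v = v) : joinLayer c v w w = v := by
  simp [joinLayer, h]

theorem leaveLayer_apply_self {c : Perm ℕ} {v : ℕ} : leaveLayer c v v = v := by
  simp [leaveLayer]

theorem leaveLayer_apply_parent {c : Perm ℕ} {v : ℕ} :
    leaveLayer c v (c.symm v) = c v := by
  simp [leaveLayer]

/-- The peer-pairing algorithm: `PairingLaw V μ` says that `μ` is the distribution of the two
layers after some finite sequence of joins and leaves that ends with `V` as the set of peers.
The network starts with the source and its loops. A new peer `v` is added to `V` and chooses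
`w 0, w 1` independently and uniformly from the enlarged `V`. Every peer but the source may
leave. -/
inductive PairingLaw : Finset ℕ → PMF Layers → Prop
  | init : PairingLaw {source} (PMF.pure 1)
  | join {V : Finset ℕ} {μ : PMF Layers} (v : ℕ) (hv : v ∉ V) (h : PairingLaw V μ) :
      PairingLaw (insert v V)
        (μ.bind fun c =>
          (PMF.uniformOfFinset (Fintype.piFinset fun _ : Fin 2 => insert v V)
            (Fintype.piFinset_nonempty.2 fun _ => Finset.insert_nonempty v V)).map
            fun w m => joinLayer (c m) v (w m))
  | leave {V : Finset ℕ} {μ : PMF Layers} (v : ℕ) (hv : v ∈ V) (hs : v ≠ source)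
      (h : PairingLaw V μ) :
      PairingLaw (V.erase v) (μ.map fun c m => leaveLayer (c m) v)

/-- All the randomness: the layers, and for every peer a coin that it uses to break a tie.
`coins` is the set of peers whose coin shows the first layer. -/
structure Outcome where
  layers : Layers
  coins : Finset ℕ

instance : MeasurableSpace Outcome := ⊤

/-- The coins are fair and independent of each other and of the layers, i.e., the set of peers in
`V` whose coin shows the first layer is a uniformly distributed subset of `V`. -/
noncomputable def outcomeLaw (V : Finset ℕ) (μ : PMF Layers) : PMF Outcome :=
  μ.bind fun c =>
    (PMF.uniformOfFinset V.powerset ⟨∅, Finset.empty_mem_powerset V⟩).map fun T => ⟨c, T⟩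

/-- The values `d(v)` and `χ(v)` held by a peer (`χ(v) = 0` : no main flow). -/
@[ext]
structure PeerState where
  depth : ℕ∞
  flow : ℕ

/-- The initial values; the source has depth `0`. -/
def initState (v : ℕ) : PeerState := if v = source then ⟨0, 0⟩ else ⟨⊤, 0⟩

/-- The `m`-th parent of `v`. -/
def parent (ω : Outcome) (m : Fin 2) (v : ℕ) : ℕ := (ω.layers m).symm v

/-- The index `m*` of the parent of smallest depth, where ties are broken by the coin of `v`.
(Only the source has depth `0`, so this selects the source if the source is a parent.) -/
def bestParent (ω : Outcome) (s : ℕ → PeerState) (v : ℕ) : Fin 2 :=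
  if (s (parent ω 0 v)).depth < (s (parent ω 1 v)).depth then 0
  else if (s (parent ω 1 v)).depth < (s (parent ω 0 v)).depth then 1
  else if v ∈ ω.coins then 0 else 1

open Classical in
/-- Every peer runs the random flow-assignment algorithm once, with depth threshold `D`:
the new values of `d(v)` and `χ(v)` from the current values of its parents. Layer indices
`0, 1` correspond to the flows `1, 2`. -/
noncomputable def rfaStep (ω : Outcome) (D : ℕ) (s : ℕ → PeerState) (v : ℕ) : PeerState :=
  if v = source then ⟨0, 0⟩
  else if ∃ m, parent ω m v = source then ⟨1, (bestParent ω s v : ℕ) + 1⟩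
  else if ∃ m, (s (parent ω m v)).depth < D then
    ⟨(s (parent ω (bestParent ω s v) v)).depth + 1,
      (s (parent ω (bestParent ω s v) v)).flow⟩
  else ⟨⊤, 0⟩

/-- The outcome of the random flow-assignment algorithm. Rerunning the algorithm does not change
any value after `D + 1` rounds, see `rfa_stable`. -/
noncomputable def rfa (ω : Outcome) (D : ℕ) : ℕ → PeerState := (rfaStep ω D)^[D + 1] initState

theorem bestParent_min (ω : Outcome) (s : ℕ → PeerState) (v : ℕ) (m : Fin 2) :
    (s (parent ω (bestParent ω s v) v)).depth ≤ (s (parent ω m v)).depth := by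
  unfold bestParent
  fin_cases m <;> split_ifs <;> simp_all [le_of_lt]

/-- `s` and `s'` agree on the peers of depth at most `t`, and no other peer has reached a depth
below `t + 1`. -/
def AgreeUpTo (t : ℕ) (s s' : ℕ → PeerState) : Prop :=
  s source = ⟨0, 0⟩ ∧ s' source = ⟨0, 0⟩ ∧ ∀ v, (s v = s' v ∧ (s v).depth ≤ (t : ℕ∞)) ∨
    (s v = ⟨⊤, 0⟩ ∧ ((t + 1 : ℕ) : ℕ∞) ≤ (s' v).depth)

theorem AgreeUpTo.best {t : ℕ} {s s' : ℕ → PeerState} (h : AgreeUpTo t s s') (ω : Outcome)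
    {v : ℕ} {m : Fin 2} (hm : (s (parent ω m v)).depth ≤ (t : ℕ∞)) :
    bestParent ω s v = bestParent ω s' v ∧
      s (parent ω (bestParent ω s v) v) = s' (parent ω (bestParent ω s v) v) ∧
      (s (parent ω (bestParent ω s v) v)).depth ≤ (t : ℕ∞) := by
  have key : (s (parent ω (bestParent ω s v) v)).depth ≤ (t : ℕ∞) :=
    (bestParent_min ω s v m).trans hm
  have lt1 : ((t : ℕ) : ℕ∞) < ((t + 1 : ℕ) : ℕ∞) := by exact_mod_cast Nat.lt_succ_self t
  have top : ¬ ((⊤ : ℕ∞) ≤ (t : ℕ∞)) := by simp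
  refine ⟨?_, ?_, key⟩
  · rcases h.2.2 (parent ω 0 v) with ⟨e0, l0⟩ | ⟨e0, l0⟩ <;>
      rcases h.2.2 (parent ω 1 v) with ⟨e1, l1⟩ | ⟨e1, l1⟩
    · simp [bestParent, e0, e1]
    · have a : (s (parent ω 0 v)).depth < (s (parent ω 1 v)).depth := by
        rw [e1]; exact lt_of_le_of_lt l0 (by simp)
      have b : (s' (parent ω 0 v)).depth < (s' (parent ω 1 v)).depth := by
        rw [← e0]; exact (l0.trans_lt lt1).trans_le l1
      simp [bestParent, a, b]
    · have a : (s (parent ω 1 v)).depth < (s (parent ω 0 v)).depth := by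
        rw [e0]; exact lt_of_le_of_lt l1 (by simp)
      have b : (s' (parent ω 1 v)).depth < (s' (parent ω 0 v)).depth := by
        rw [← e1]; exact (l1.trans_lt lt1).trans_le l0
      simp [bestParent, a, b, a.not_gt, b.not_gt]
    · exfalso
      fin_cases m
      · simp [e0] at hm
      · simp [e1] at hm
  · rcases h.2.2 (parent ω (bestParent ω s v) v) with ⟨e, -⟩ | ⟨e, -⟩
    · exact e
    · rw [e] at key; exact absurd key top

theorem AgreeUpTo.step {t : ℕ} {s s' : ℕ → PeerState} (h : AgreeUpTo t s s') (ω : Outcome)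
    (D : ℕ) : AgreeUpTo (t + 1) (rfaStep ω D s) (rfaStep ω D s') := by
  refine ⟨by simp [rfaStep], by simp [rfaStep], fun v => ?_⟩
  by_cases hv : v = source
  · left; simp [rfaStep, hv]
  by_cases hp : ∃ m, parent ω m v = source
  · obtain ⟨m, hm⟩ := hp
    have hb := (h.best ω (v := v) (m := m) (by rw [hm, h.1]; simp)).1
    left
    have hp : ∃ m, parent ω m v = source := ⟨m, hm⟩
    simp only [rfaStep, if_neg hv, if_pos hp, hb, true_and]
    simp
  by_cases hd : ∃ m, (s (parent ω m v)).depth < D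
  · obtain ⟨m, hm⟩ := hd
    have hmt : (s (parent ω m v)).depth ≤ (t : ℕ∞) := by
      rcases h.2.2 (parent ω m v) with ⟨-, l⟩ | ⟨e, -⟩
      · exact l
      · simp [e] at hm
    obtain ⟨b1, b2, b3⟩ := h.best ω hmt
    have hd : ∃ m, (s (parent ω m v)).depth < D := ⟨m, hm⟩
    have hd' : ∃ m, (s' (parent ω m v)).depth < D :=
      ⟨bestParent ω s v, by rw [← b2]; exact (bestParent_min ω s v m).trans_lt hm⟩
    left
    simp only [rfaStep, if_neg hv, if_neg hp, if_pos hd, if_pos hd', ← b1, ← b2, true_and]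
    push_cast
    gcongr
  · right
    refine ⟨by simp only [rfaStep, if_neg hv, if_neg hp, if_neg hd], ?_⟩
    by_cases hd' : ∃ m, (s' (parent ω m v)).depth < D
    · simp only [rfaStep, if_neg hv, if_neg hp, if_pos hd']
      obtain ⟨m, hm⟩ := hd'
      have hb := (bestParent_min ω s' v m).trans_lt hm
      rcases h.2.2 (parent ω (bestParent ω s' v) v) with ⟨e, -⟩ | ⟨-, l⟩
      · exact absurd ⟨_, by rw [e]; exact hb⟩ hd
      · rw [Nat.cast_add (t + 1) 1]
        gcongr
        simp
    · simp only [rfaStep, if_neg hv, if_neg hp, if_neg hd']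
      exact le_top

theorem agreeUpTo_iterate (ω : Outcome) (D t : ℕ) :
    AgreeUpTo t ((rfaStep ω D)^[t] initState) ((rfaStep ω D)^[t + 1] initState) := by
  induction t with
  | zero =>
    refine ⟨by simp [initState], by simp [rfaStep], fun v => ?_⟩
    by_cases hv : v = source
    · left; simp [rfaStep, initState, hv]
    · right
      refine ⟨by simp [initState, hv], ?_⟩
      simp only [zero_add, Function.iterate_one, rfaStep, if_neg hv]
      split_ifs <;> simp
  | succ t ih =>
    rw [Function.iterate_succ_apply', Function.iterate_succ_apply' _ (t + 1)]
    exact ih.step ω D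

theorem rfa_stable (ω : Outcome) (D : ℕ) : rfaStep ω D (rfa ω D) = rfa ω D := by
  have h := agreeUpTo_iterate ω D (D + 1)
  rw [Function.iterate_succ_apply' _ (D + 1)] at h
  change AgreeUpTo (D + 1) (rfa ω D) (rfaStep ω D (rfa ω D)) at h
  funext v
  rcases h.2.2 v with ⟨e, -⟩ | ⟨e, l⟩
  · exact e.symm
  rw [e]
  revert l
  unfold rfaStep
  have two : ¬ (((D + 1 + 1 : ℕ) : ℕ∞) ≤ 1) := by
    intro l
    have : D + 1 + 1 ≤ 1 := by exact_mod_cast l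
    omega
  split_ifs with h1 h2 h3
  · intro l; exact absurd (l.trans (by simp)) two
  · intro l; exact absurd l two
  · intro l
    obtain ⟨m, hm⟩ := h3
    have hb := (bestParent_min ω (rfa ω D) v m).trans_lt hm
    have l2 := l.trans (add_le_add_left hb.le 1)
    have : D + 1 + 1 ≤ D + 1 := by exact_mod_cast l2
    omega
  · intro _; rfl

/-- `N_d`, the number of peers in depth `d`. -/
noncomputable def levelCount (V : Finset ℕ) (D : ℕ) (ω : Outcome) (d : ℕ) : ℕ :=
  {v ∈ V | (rfa ω D v).depth = d}.card

open Classical in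
/-- `X_d`, the number of flow-1 peers in depth `d`. -/
noncomputable def flowOneCount (V : Finset ℕ) (D : ℕ) (ω : Outcome) (d : ℕ) : ℕ :=
  {v ∈ V | (rfa ω D v).depth = d ∧ (rfa ω D v).flow = 1}.card

/-- `d* = ⌈log₂ (N / log^c N)⌉`. -/
noncomputable def dStar (c : ℝ) (N : ℕ) : ℕ := ⌈Real.logb 2 (N / Real.log N ^ c)⌉₊

/-- `d₁ = ⌈(log₂ N) / 3⌉`. -/
noncomputable def dOne (N : ℕ) : ℕ := ⌈Real.logb 2 N / 3⌉₊

/-- `d₂ = ⌈5 (log₂ N) / 6⌉`. -/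
noncomputable def dTwo (N : ℕ) : ℕ := ⌈5 * Real.logb 2 N / 6⌉₊

/-- `φ_d`, where `n h` is the number of peers in depth `h`, so that
`N - ∑ h < d, n h` is the number of peers beyond depth `d - 1`. -/
noncomputable def phi (N : ℕ) (n : ℕ → ℕ) (d : ℕ) : ℝ :=
  if d < dOne N then 1
  else if d < dTwo N then 1 - (N : ℝ) ^ (-(1 / 9) : ℝ)
  else (1 - (n d : ℝ) / ((N : ℝ) - ∑ h ∈ Finset.range d, (n h : ℝ))) ^ 3

/-- `n_d ≥ 2 φ_{d-1} n_{d-1}` for all `1 ≤ d ≤ d*`. -/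
def NearBinary (c : ℝ) (N : ℕ) (n : ℕ → ℕ) : Prop :=
  ∀ d, 1 ≤ d → d ≤ dStar c N → 2 * phi N n (d - 1) * (n (d - 1) : ℝ) ≤ (n d : ℝ)

/-- `|X_d / N_d - 1/2| < ε` for all `1 ≤ d ≤ d*`. -/
def Balanced (c ε : ℝ) (V : Finset ℕ) (ω : Outcome) : Prop :=
  ∀ d, 1 ≤ d → d ≤ dStar c V.card →
    |(flowOneCount V (dStar c V.card) ω d : ℝ) / (levelCount V (dStar c V.card) ω d : ℝ) - 1 / 2|
      < ε

/-- `1 - 2 log₂ N / exp ((1 - ε) N^{1/3} / (4 log₂⁴ N))`. -/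
noncomputable def lowerBound (ε : ℝ) (N : ℕ) : ℝ :=
  1 - 2 * Real.logb 2 N /
    Real.exp ((1 - ε) * (N : ℝ) ^ (1 / 3 : ℝ) / (4 * Real.logb 2 N ^ 4))

end P2P

namespace P2P

open Equiv Filter

/-! Joins and leaves keep the two layers independent and uniform over the permutations of `V`
(`PairingLaw.eq_uniform`). With the coins, all outcomes are therefore equally likely on a finite
set, and conditional probabilities are ratios of cardinalities.

The heart is a symmetry. Fix a depth `d ≥ 1`, take one permutation per layer of the set of peers in
depth `d`, and apply it to the parents of all peers. Parents keep their depths, so every depth,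
every choice of best parent and every flow up to depth `d` stay the same; only the flow inherited in
depth `d + 1` is redrawn. Any event determined by the level sizes is invariant. Averaging over the
permutations, the flow-1 peers in depth `d + 1` are counted by sampling without replacement, in each
layer, from the flows in depth `d`. The exponential moments of such a sample are at most those of
sampling with replacement (`sum_perm_exp_le`), so a Chernoff bound shows that the proportion moves
by more than `δ` with conditional probability at most `2 exp (-θ δ² / 4)`, where `θ` bounds the size
of level `d + 1` from below (`card_flowOne_deviation_le`).

Near-binary growth supplies the rest. Up to depth `d₁` the levels double exactly, so the proportion
starts at `1/2` and does not move; from there on levels do not shrink and have at least `N^{1/3}`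
peers. There are at most `log₂ N` further steps, so `δ = ε / log₂ N` and a union bound suffice
(`card_not_balanced_le`). The conditioning event has positive probability because a complete binary
tree is a possible outcome (`exists_levelCount_eq_two_pow`). -/

/-! ### Depth and flow as solutions of the fixed-point equation. -/

theorem rfa_source (ω : Outcome) (D : ℕ) : rfa ω D source = ⟨0, 0⟩ := by
  rw [← rfa_stable]; simp [rfaStep]

theorem depth_source_ne_succ (ω : Outcome) (D d : ℕ) :
    (rfa ω D source).depth ≠ (d + 1 : ℕ) := by
  rw [rfa_source]
  change ((0 : ℕ) : ℕ∞) ≠ (d + 1 : ℕ)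
  exact_mod_cast (Nat.succ_ne_zero d).symm

theorem rfa_of_parent_eq_source (ω : Outcome) (D : ℕ) {v : ℕ} (hv : v ≠ source)
    (h : ∃ m, parent ω m v = source) :
    rfa ω D v = ⟨1, (bestParent ω (rfa ω D) v : ℕ) + 1⟩ := by
  conv_lhs => rw [← rfa_stable]
  simp only [rfaStep, if_neg hv, if_pos h]

theorem rfa_of_parent_ne_source (ω : Outcome) (D : ℕ) {v : ℕ} (hv : v ≠ source)
    (h : ¬ ∃ m, parent ω m v = source) (hd : ∃ m, (rfa ω D (parent ω m v)).depth < D) :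
    rfa ω D v = ⟨(rfa ω D (parent ω (bestParent ω (rfa ω D) v) v)).depth + 1,
      (rfa ω D (parent ω (bestParent ω (rfa ω D) v) v)).flow⟩ := by
  conv_lhs => rw [← rfa_stable]
  simp only [rfaStep, if_neg hv, if_neg h, if_pos hd]

theorem rfa_of_parent_deep (ω : Outcome) (D : ℕ) {v : ℕ} (hv : v ≠ source)
    (h : ¬ ∃ m, parent ω m v = source) (hd : ¬ ∃ m, (rfa ω D (parent ω m v)).depth < D) :
    rfa ω D v = ⟨⊤, 0⟩ := by
  conv_lhs => rw [← rfa_stable]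
  simp only [rfaStep, if_neg hv, if_neg h, if_neg hd]

/-- A child of the source obeys the general recursion too: its best parent has depth `0`. Depth
arguments therefore need no separate case for it. -/
theorem depth_eq_succ (ω : Outcome) {D : ℕ} {v : ℕ} (hv : v ≠ source)
    (hd : ∃ m, (rfa ω D (parent ω m v)).depth < D) :
    (rfa ω D v).depth = (rfa ω D (parent ω (bestParent ω (rfa ω D) v) v)).depth + 1 := by
  by_cases h : ∃ m, parent ω m v = source
  · rw [rfa_of_parent_eq_source ω D hv h]
    obtain ⟨m, hm⟩ := h
    have := bestParent_min ω (rfa ω D) v m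
    rw [hm, rfa_source] at this
    rw [nonpos_iff_eq_zero.1 this]
    simp
  · rw [rfa_of_parent_ne_source ω D hv h hd]

theorem depth_eq_top {ω : Outcome} {D : ℕ} (hD : 1 ≤ D) {v : ℕ} (hv : v ≠ source)
    (hd : ¬ ∃ m, (rfa ω D (parent ω m v)).depth < D) : (rfa ω D v).depth = ⊤ := by
  rw [rfa_of_parent_deep ω D hv _ hd]
  rintro ⟨m, hm⟩
  refine hd ⟨m, ?_⟩
  rw [hm, rfa_source]
  change (0 : ℕ∞) < D
  exact_mod_cast hD

theorem depth_eq_zero_iff {ω : Outcome} {D : ℕ} (hD : 1 ≤ D) {v : ℕ} :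
    (rfa ω D v).depth = 0 ↔ v = source := by
  refine ⟨fun h => ?_, fun h => by rw [h, rfa_source]⟩
  by_contra hv
  by_cases hd : ∃ m, (rfa ω D (parent ω m v)).depth < D
  · rw [depth_eq_succ ω hv hd] at h; simp at h
  · rw [depth_eq_top hD hv hd] at h; simp at h

theorem depth_le_or_eq_top {ω : Outcome} {D : ℕ} (hD : 1 ≤ D) (v : ℕ) :
    (rfa ω D v).depth ≤ D ∨ (rfa ω D v).depth = ⊤ := by
  by_cases hv : v = source
  · rw [hv, rfa_source]; simp
  by_cases hd : ∃ m, (rfa ω D (parent ω m v)).depth < D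
  · left
    rw [depth_eq_succ ω hv hd]
    obtain ⟨m, hm⟩ := hd
    exact Order.add_one_le_of_lt ((bestParent_min ω (rfa ω D) v m).trans_lt hm)
  · exact Or.inr (depth_eq_top hD hv hd)

theorem depth_bestParent {ω : Outcome} {D : ℕ} (hD : 1 ≤ D) {v d : ℕ}
    (h : (rfa ω D v).depth = (d + 1 : ℕ)) :
    (rfa ω D (parent ω (bestParent ω (rfa ω D) v) v)).depth = d := by
  have hv : v ≠ source := by
    rintro rfl
    exact depth_source_ne_succ ω D d h
  by_cases hd : ∃ m, (rfa ω D (parent ω m v)).depth < D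
  · rw [depth_eq_succ ω hv hd] at h
    push_cast at h
    exact WithTop.add_right_cancel (WithTop.coe_ne_top (a := 1)) h
  · exact absurd h (by rw [depth_eq_top hD hv hd]; exact (ENat.natCast_ne_top _).symm)

/-- Depth is breadth-first: membership in the next level depends only on the earlier levels and on
parenthood. Inductions over depth rest on this form, which mentions neither flows nor coins. -/
theorem depth_eq_succ_iff {ω : Outcome} {D : ℕ} (hD : 1 ≤ D) {v d : ℕ} (hd : d < D) :
    (rfa ω D v).depth = (d + 1 : ℕ) ↔
      (∃ m, (rfa ω D (parent ω m v)).depth = d) ∧ ∀ j ≤ d, (rfa ω D v).depth ≠ j := by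
  refine ⟨fun h => ⟨⟨_, depth_bestParent hD h⟩, fun j hj e => ?_⟩, fun ⟨⟨m, hm⟩, h⟩ => ?_⟩
  · rw [h] at e
    have : d + 1 = j := by exact_mod_cast e
    omega
  · have hv : v ≠ source := by
      rintro rfl
      exact h 0 (Nat.zero_le _) (by rw [rfa_source]; simp)
    have hlt : ∃ m, (rfa ω D (parent ω m v)).depth < D := ⟨m, by rw [hm]; exact_mod_cast hd⟩
    have e := depth_eq_succ ω hv hlt
    have l := bestParent_min ω (rfa ω D) v m
    rw [hm] at l
    obtain ⟨k, hk⟩ := ENat.ne_top_iff_exists.1 (ne_top_of_le_ne_top (by simp) l)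
    rw [← hk] at e l
    have l' : k ≤ d := by exact_mod_cast l
    have : k + 1 = d + 1 := by
      by_contra hne
      exact h (k + 1) (by omega) (by rw [e]; simp)
    rw [e, ← this]; simp

theorem flow_eq_flow_bestParent {ω : Outcome} {D : ℕ} (hD : 1 ≤ D) {v d : ℕ} (hd : 1 ≤ d)
    (h : (rfa ω D v).depth = (d + 1 : ℕ)) :
    (rfa ω D v).flow = (rfa ω D (parent ω (bestParent ω (rfa ω D) v) v)).flow := by
  have hv : v ≠ source := by
    rintro rfl
    exact depth_source_ne_succ ω D d h
  have hp : ¬ ∃ m, parent ω m v = source := by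
    intro hp
    rw [rfa_of_parent_eq_source ω D hv hp] at h
    change ((1 : ℕ) : ℕ∞) = (d + 1 : ℕ) at h
    have : 1 = d + 1 := by exact_mod_cast h
    omega
  have hlt : ∃ m, (rfa ω D (parent ω m v)).depth < D := by
    by_contra hlt
    exact absurd h (by rw [depth_eq_top hD hv hlt]; exact (ENat.natCast_ne_top _).symm)
  rw [rfa_of_parent_ne_source ω D hv hp hlt]

theorem flow_eq_bestParent {ω : Outcome} {D : ℕ} (hD : 1 ≤ D) {v : ℕ}
    (h : (rfa ω D v).depth = 1) :
    (rfa ω D v).flow = (bestParent ω (rfa ω D) v : ℕ) + 1 := by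
  have hv : v ≠ source := by
    rintro rfl
    rw [rfa_source] at h
    simp at h
  have h' : (rfa ω D v).depth = (0 + 1 : ℕ) := by rw [h]; simp
  have := depth_bestParent hD h'
  rw [Nat.cast_zero, depth_eq_zero_iff hD] at this
  rw [rfa_of_parent_eq_source ω D hv ⟨_, this⟩]

/-! ### Invariance under permutations of the parents. -/

/-- The outcome in which the parents in layer `m` are permuted by `σ m`. -/
def permuteParents (σ : Layers) (ω : Outcome) : Outcome :=
  ⟨fun m => ω.layers m * (σ m)⁻¹, ω.coins⟩

theorem parent_permuteParents (σ : Layers) (ω : Outcome) (m : Fin 2) (v : ℕ) :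
    parent (permuteParents σ ω) m v = σ m (parent ω m v) := by
  simp [parent, permuteParents, Equiv.symm_apply_eq]

section
variable {σ : Layers} {ω : Outcome} {D : ℕ}

/-- The breadth-first description of a level asks only for the depths of the parents, which `σ` does
not alter. Infinite depth follows by exclusion, since finite depths are at most `D`. -/
theorem depth_permuteParents (hD : 1 ≤ D)
    (hσ : ∀ m v, (rfa ω D (σ m v)).depth = (rfa ω D v).depth) (v : ℕ) :
    (rfa (permuteParents σ ω) D v).depth = (rfa ω D v).depth := by
  have key : ∀ k ≤ D, ∀ j ≤ k, ∀ v,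
      (rfa (permuteParents σ ω) D v).depth = j ↔ (rfa ω D v).depth = j := by
    intro k
    induction k with
    | zero =>
      intro _ j hj v
      obtain rfl : j = 0 := by omega
      simp only [Nat.cast_zero, depth_eq_zero_iff hD]
    | succ k ih =>
      intro hk j hj v
      rcases Nat.lt_or_ge j (k + 1) with h | h
      · exact ih (by omega) j (by omega) v
      obtain rfl : j = k + 1 := by omega
      rw [depth_eq_succ_iff hD (by omega), depth_eq_succ_iff hD (by omega)]
      have ih' := ih (by omega)
      refine and_congr (exists_congr fun m => ?_) (forall₂_congr fun j hj => ?_)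
      · rw [ih' k le_rfl, parent_permuteParents, hσ]
      · rw [Ne, ih' j hj]
  rcases depth_le_or_eq_top (ω := ω) hD v with h | h
  · obtain ⟨j, hj⟩ := ENat.ne_top_iff_exists.1 (ne_top_of_le_ne_top (by simp) h)
    rw [← hj] at h ⊢
    exact (key D le_rfl j (by exact_mod_cast h) v).2 hj.symm
  · rw [h]
    rcases depth_le_or_eq_top (ω := permuteParents σ ω) hD v with h' | h'
    · obtain ⟨j, hj⟩ := ENat.ne_top_iff_exists.1 (ne_top_of_le_ne_top (by simp) h')
      rw [← hj] at h'
      rw [(key D le_rfl j (by exact_mod_cast h') v).1 hj.symm] at h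
      simp at h
    · exact h'

theorem bestParent_permuteParents (hD : 1 ≤ D)
    (hσ : ∀ m v, (rfa ω D (σ m v)).depth = (rfa ω D v).depth) (v : ℕ) :
    bestParent (permuteParents σ ω) (rfa (permuteParents σ ω) D) v =
      bestParent ω (rfa ω D) v := by
  simp only [bestParent, depth_permuteParents hD hσ, parent_permuteParents, hσ]
  rfl

/-- A peer of positive depth at most `k` has its best parent in a depth below `k`, where `σ` moves
nothing; in depth `1` the flow is the layer of the best parent. -/
theorem flow_permuteParents {k : ℕ} (hD : 1 ≤ D)
    (hσ : ∀ m v, (rfa ω D (σ m v)).depth = (rfa ω D v).depth)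
    (hfix : ∀ m v, (rfa ω D v).depth ≠ k → σ m v = v) {j : ℕ} (hj : j ≤ k) :
    ∀ v, (rfa ω D v).depth = j →
      (rfa (permuteParents σ ω) D v).flow = (rfa ω D v).flow := by
  induction j with
  | zero =>
    intro v hv
    rw [Nat.cast_zero, depth_eq_zero_iff hD] at hv
    rw [hv, rfa_source, rfa_source]
  | succ j ih =>
    intro v hv
    have hv' := hv
    rw [← depth_permuteParents hD hσ] at hv'
    rcases Nat.eq_zero_or_pos j with rfl | hj0
    · rw [flow_eq_bestParent hD (by simpa using hv'), flow_eq_bestParent hD (by simpa using hv),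
        bestParent_permuteParents hD hσ]
    · have hb := depth_bestParent hD hv
      rw [flow_eq_flow_bestParent hD hj0 hv, flow_eq_flow_bestParent hD hj0 hv',
        bestParent_permuteParents hD hσ, parent_permuteParents, hfix, ih (by omega) _ hb]
      rw [hb]
      intro e
      have : j = k := by exact_mod_cast e
      omega

/-- This is where the randomization acts: depth `k + 1` reads the old flows of depth `k` at a
permuted place. It needs `1 ≤ k` because flows in depth `1` are created, not inherited. -/
theorem flow_permuteParents_succ {k : ℕ} (hk : 1 ≤ k) (hD : 1 ≤ D)
    (hσ : ∀ m v, (rfa ω D (σ m v)).depth = (rfa ω D v).depth)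
    (hfix : ∀ m v, (rfa ω D v).depth ≠ k → σ m v = v) {v : ℕ}
    (hv : (rfa ω D v).depth = (k + 1 : ℕ)) :
    (rfa (permuteParents σ ω) D v).flow =
      (rfa ω D (σ (bestParent ω (rfa ω D) v) (parent ω (bestParent ω (rfa ω D) v) v))).flow := by
  have hv' := hv
  rw [← depth_permuteParents hD hσ] at hv'
  rw [flow_eq_flow_bestParent hD hk hv', bestParent_permuteParents hD hσ, parent_permuteParents,
    flow_permuteParents hD hσ hfix le_rfl]
  rw [hσ, depth_bestParent hD hv]

end

/-! ### Exponential moments of sampling without replacement. -/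

/-- In probabilistic terms, a uniform permutation of `n` points maps `S` into `X` with probability
at most `(|X| / n) ^ |S|`. Given that `S` lands in `X`, a further point does so with probability
`(|X| - |S|) / (n - |S|) ≤ |X| / n`. -/
theorem card_perm_mapsTo_mul_le {α : Type*} [Fintype α] [DecidableEq α] (X S : Finset α) :
    ({σ : Perm α | ∀ b ∈ S, σ b ∈ X} : Finset (Perm α)).card * Fintype.card α ^ S.card ≤
      (Fintype.card α).factorial * X.card ^ S.card := by
  induction S using Finset.induction_on with
  | empty => simp [Fintype.card_perm]
  | insert b S hb ih =>
    set P : Finset (Perm α) := {σ : Perm α | ∀ b ∈ S, σ b ∈ X} with hP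
    set Q : α → Finset (Perm α) := fun y => {σ ∈ P | σ y ∈ X} with hQ
    have hQb : ({σ : Perm α | ∀ a ∈ insert b S, σ a ∈ X} : Finset (Perm α)) = Q b := by
      ext σ; simp [hQ, hP, and_comm]
    -- All points outside `S` play the same role: exchange `y` and `b` before applying `σ`.
    have hsymm : ∀ y ∉ S, (Q y).card = (Q b).card := by
      intro y hy
      refine Finset.card_bij' (fun σ _ => σ * swap y b) (fun σ _ => σ * swap y b) ?_ ?_ ?_ ?_
      · intro σ hσ
        simp only [hQ, hP, Finset.mem_filter, Finset.mem_univ, true_and] at hσ ⊢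
        refine ⟨fun a ha => ?_, by simpa using hσ.2⟩
        rw [Perm.mul_apply, swap_apply_of_ne_of_ne (by rintro rfl; exact hy ha)
          (by rintro rfl; exact hb ha)]
        exact hσ.1 a ha
      · intro σ hσ
        simp only [hQ, hP, Finset.mem_filter, Finset.mem_univ, true_and] at hσ ⊢
        refine ⟨fun a ha => ?_, by simpa using hσ.2⟩
        rw [Perm.mul_apply, swap_apply_of_ne_of_ne (by rintro rfl; exact hy ha)
          (by rintro rfl; exact hb ha)]
        exact hσ.1 a ha
      · intro σ _; simp [mul_assoc]
      · intro σ _; simp [mul_assoc]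
    -- Double counting of the pairs `(σ, y)` with `σ ∈ P`, `y ∉ S` and `σ y ∈ X`. If `|X| < |S|`,
    -- then `P` is empty and the truncated subtraction is harmless.
    have hcount : (Fintype.card α - S.card) * (Q b).card = (X.card - S.card) * P.card := by
      have h1 : ∑ y ∈ Finset.univ \ S, (Q y).card = (Fintype.card α - S.card) * (Q b).card := by
        rw [Finset.sum_congr rfl fun y hy => hsymm y (by simpa using hy), Finset.sum_const,
          Finset.card_univ_sdiff, smul_eq_mul]
      rw [← h1]
      simp only [hQ, Finset.card_filter]
      rw [Finset.sum_comm, mul_comm, ← smul_eq_mul, ← Finset.sum_const]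
      refine Finset.sum_congr rfl fun σ hσ => ?_
      simp only [hP, Finset.mem_filter, Finset.mem_univ, true_and] at hσ
      rw [← Finset.card_filter]
      have : ({y ∈ Finset.univ \ S | σ y ∈ X} : Finset α) = X.map σ.symm.toEmbedding \ S := by
        ext y
        simp [and_comm]
      rw [this, Finset.card_sdiff_of_subset, Finset.card_map]
      intro y hy
      simpa using hσ y hy
    rw [hQb, Finset.card_insert_of_notMem hb, pow_succ, pow_succ]
    have hSn : S.card < Fintype.card α := by
      rw [← Finset.card_univ]
      exact Finset.card_lt_card ⟨Finset.subset_univ S, fun h => hb (h (Finset.mem_univ b))⟩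
    have hfrac : (X.card - S.card) * Fintype.card α ≤ X.card * (Fintype.card α - S.card) := by
      have hX : X.card ≤ Fintype.card α := Finset.card_le_univ X
      rcases le_total X.card S.card with h | h
      · simp [Nat.sub_eq_zero_of_le h]
      · zify [h, hSn.le]
        nlinarith
    refine Nat.le_of_mul_le_mul_left ?_ (Nat.sub_pos_of_lt hSn)
    calc (Fintype.card α - S.card) * ((Q b).card * (Fintype.card α ^ S.card * Fintype.card α))
        = ((Fintype.card α - S.card) * (Q b).card) *
            (Fintype.card α ^ S.card * Fintype.card α) := by ring
      _ = (P.card * Fintype.card α ^ S.card) * ((X.card - S.card) * Fintype.card α) := by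
          rw [hcount]; ring
      _ ≤ ((Fintype.card α).factorial * X.card ^ S.card) *
            (X.card * (Fintype.card α - S.card)) := Nat.mul_le_mul ih hfrac
      _ = _ := by ring

/-- The exponential is a product of factors `1 + (exp s - 1) 1[σ b ∈ X]`. Expanded over subsets it
has nonnegative coefficients as `s ≥ 0`, so the bounds for single subsets add up to the moment of a
binomial variable. -/
theorem sum_perm_exp_le {α : Type*} [Fintype α] [DecidableEq α] (X B : Finset α) {s : ℝ}
    (hs0 : 0 ≤ s) (hs1 : s ≤ 1) :
    ∑ σ : Perm α, Real.exp (s * ({b ∈ B | σ b ∈ X} : Finset α).card) ≤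
      (Fintype.card (Perm α) : ℝ) *
        Real.exp (B.card * ((X.card : ℝ) / Fintype.card α * s + s ^ 2)) := by
  set p : ℝ := (X.card : ℝ) / Fintype.card α with hp
  have hp0 : 0 ≤ p := by positivity
  have hp1 : p ≤ 1 := div_le_one_of_le₀ (by exact_mod_cast Finset.card_le_univ X) (by positivity)
  have hx : 0 ≤ Real.exp s - 1 := by linarith [Real.add_one_le_exp s]
  have hterm : ∀ σ : Perm α, Real.exp (s * ({b ∈ B | σ b ∈ X} : Finset α).card) =
      ∑ S ∈ B.powerset, (if ∀ b ∈ S, σ b ∈ X then (Real.exp s - 1) ^ S.card else 0) := by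
    intro σ
    have h1 : Real.exp (s * ({b ∈ B | σ b ∈ X} : Finset α).card) =
        ∏ b ∈ B, ((if σ b ∈ X then Real.exp s - 1 else 0) + 1) := by
      rw [mul_comm, Real.exp_nat_mul, ← Finset.prod_const, Finset.prod_filter]
      refine Finset.prod_congr rfl fun b _ => ?_
      split_ifs <;> ring
    rw [h1, Finset.prod_add]
    refine Finset.sum_congr rfl fun S _ => ?_
    simp only [Finset.prod_const_one, mul_one]
    split_ifs with h
    · rw [Finset.prod_congr rfl fun b hb => if_pos (h b hb), Finset.prod_const]
    · push Not at h
      obtain ⟨b, hb, hbX⟩ := h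
      exact Finset.prod_eq_zero hb (if_neg hbX)
  have hcount : ∀ S ∈ B.powerset,
      (({σ : Perm α | ∀ b ∈ S, σ b ∈ X} : Finset (Perm α)).card : ℝ) ≤
        Fintype.card (Perm α) * p ^ S.card := by
    intro S _
    rcases Nat.eq_zero_or_pos (Fintype.card α) with h0 | h0
    · have : S = ∅ := by
        rw [← Finset.card_eq_zero]
        exact Nat.le_zero.1 ((Finset.card_le_univ S).trans h0.le)
      subst this; simp
    rw [hp, div_pow, mul_div_assoc', le_div_iff₀ (by positivity), Fintype.card_perm]
    exact_mod_cast card_perm_mapsTo_mul_le X S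
  calc ∑ σ : Perm α, Real.exp (s * ({b ∈ B | σ b ∈ X} : Finset α).card)
      = ∑ S ∈ B.powerset, (({σ : Perm α | ∀ b ∈ S, σ b ∈ X} : Finset (Perm α)).card : ℝ) *
          (Real.exp s - 1) ^ S.card := by
        rw [Finset.sum_congr rfl fun σ _ => hterm σ, Finset.sum_comm]
        refine Finset.sum_congr rfl fun S _ => ?_
        rw [← Finset.sum_filter, Finset.sum_const, nsmul_eq_mul]
    _ ≤ ∑ S ∈ B.powerset, (Fintype.card (Perm α) * p ^ S.card) *
          (Real.exp s - 1) ^ S.card := by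
        refine Finset.sum_le_sum fun S hS => ?_
        exact mul_le_mul_of_nonneg_right (hcount S hS) (pow_nonneg hx _)
    _ = Fintype.card (Perm α) * (p * (Real.exp s - 1) + 1) ^ B.card := by
        rw [← Finset.prod_const, Finset.prod_add, Finset.mul_sum]
        refine Finset.sum_congr rfl fun S _ => ?_
        simp only [Finset.prod_const, one_pow, mul_one, mul_pow]
        ring
    _ ≤ _ := by
        refine mul_le_mul_of_nonneg_left ?_ (by positivity)
        rw [Real.exp_nat_mul]
        refine pow_le_pow_left₀ (by positivity) ?_ _
        refine le_trans ?_ (Real.add_one_le_exp _)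
        -- With `exp s - 1 ≤ s + s²` and `p ≤ 1`, the base `1 + p (exp s - 1)` is at most `1 + p s +
        -- s²`.
        have := (abs_le.1 (Real.abs_exp_sub_one_sub_id_le (x := s) (by rwa [abs_of_nonneg hs0]))).2
        nlinarith [sq_nonneg s]

/-! ### Uniformity of the layers and of the outcomes. -/

/-- The permutations of the labels that fix every label outside `V`. -/
def permsOn (V : Finset ℕ) : Finset (Perm ℕ) :=
  Finset.univ.map ⟨Perm.ofSubtype (p := (· ∈ V)), Perm.ofSubtype_injective⟩

theorem mem_permsOn {V : Finset ℕ} {c : Perm ℕ} : c ∈ permsOn V ↔ ∀ x ∉ V, c x = x := by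
  simp only [permsOn, Finset.mem_map, Finset.mem_univ, true_and, Function.Embedding.coeFn_mk]
  constructor
  · rintro ⟨σ, rfl⟩ x hx
    exact Perm.ofSubtype_apply_of_not_mem σ hx
  · intro h
    have h' : ∀ x, c x ≠ x → x ∈ V := fun x hx => by_contra fun hV => hx (h x hV)
    have hV : ∀ x, c x ∈ V ↔ x ∈ V := by
      refine fun x => not_iff_not.1 ⟨fun hx => ?_, fun hx => by rwa [h x hx]⟩
      have := c.injective (h _ hx)
      rwa [this] at hx
    exact ⟨c.subtypePerm hV, Perm.ofSubtype_subtypePerm hV h'⟩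

theorem apply_mem_of_mem_permsOn {V : Finset ℕ} {c : Perm ℕ} (hc : c ∈ permsOn V) {x : ℕ} :
    c x ∈ V ↔ x ∈ V := by
  rw [mem_permsOn] at hc
  refine not_iff_not.1 ⟨fun h => ?_, fun h => by rwa [hc x h]⟩
  have := c.injective (hc _ h)
  rwa [this] at h

theorem mul_mem_permsOn {V : Finset ℕ} {c c' : Perm ℕ} (hc : c ∈ permsOn V)
    (hc' : c' ∈ permsOn V) : c * c' ∈ permsOn V := by
  rw [mem_permsOn] at *
  intro x hx
  rw [Perm.mul_apply, hc' x hx, hc x hx]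

theorem inv_mem_permsOn {V : Finset ℕ} {c : Perm ℕ} (hc : c ∈ permsOn V) :
    c⁻¹ ∈ permsOn V := by
  rw [mem_permsOn] at *
  intro x hx
  rw [Perm.inv_eq_iff_eq, hc x hx]

theorem permsOn_mono {V W : Finset ℕ} (h : V ⊆ W) : permsOn V ⊆ permsOn W := fun c hc => by
  rw [mem_permsOn] at *
  exact fun x hx => hc x fun hV => hx (h hV)

theorem swap_mem_permsOn {V : Finset ℕ} {x y : ℕ} (hx : x ∈ V) (hy : y ∈ V) :
    swap x y ∈ permsOn V := by
  rw [mem_permsOn]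
  intro z hz
  exact swap_apply_of_ne_of_ne (by rintro rfl; exact hz hx) (by rintro rfl; exact hz hy)

/-- The pairs of permutations of `V`. -/
def layersOn (V : Finset ℕ) : Finset Layers := Fintype.piFinset fun _ => permsOn V

theorem mem_layersOn {V : Finset ℕ} {c : Layers} : c ∈ layersOn V ↔ ∀ m, c m ∈ permsOn V :=
  Fintype.mem_piFinset

theorem layersOn_nonempty (V : Finset ℕ) : (layersOn V).Nonempty :=
  ⟨1, mem_layersOn.2 fun _ => mem_permsOn.2 fun _ _ => rfl⟩

/-- Two independent uniform choices form a uniform pair, and a bijection keeps it uniform. This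
serves joins, leaves and the coins alike. -/
theorem uniformOfFinset_bind_map {α β γ : Type*} {A : Finset α} {W : Finset β} {B : Finset γ}
    (hA : A.Nonempty) (hW : W.Nonempty) (hB : B.Nonempty) (g : α → β → γ)
    (hg : Set.BijOn (fun x : α × β => g x.1 x.2) (A ×ˢ W : Finset (α × β)) B) :
    ((PMF.uniformOfFinset A hA).bind fun a => (PMF.uniformOfFinset W hW).map (g a)) =
      PMF.uniformOfFinset B hB := by
  classical
  have hcard : B.card = A.card * W.card := by
    rw [← Finset.card_product]
    exact (Finset.card_nbij _ hg.mapsTo hg.injOn hg.surjOn).symm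
  have hsum : ∀ c, ((PMF.uniformOfFinset A hA).bind fun a =>
      (PMF.uniformOfFinset W hW).map (g a)) c =
      ∑ x ∈ A ×ˢ W, if c = g x.1 x.2 then (B.card : ENNReal)⁻¹ else 0 := by
    intro c
    rw [PMF.bind_apply, tsum_eq_sum (s := A), Finset.sum_product]
    · refine Finset.sum_congr rfl fun a ha => ?_
      rw [PMF.map_apply, tsum_eq_sum (s := W), PMF.uniformOfFinset_apply_of_mem _ ha,
        Finset.mul_sum]
      · refine Finset.sum_congr rfl fun b hb => ?_
        rw [PMF.uniformOfFinset_apply_of_mem _ hb, hcard, mul_ite, mul_zero, Nat.cast_mul,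
          ENNReal.mul_inv (Or.inr (ENNReal.natCast_ne_top _)) (Or.inl (ENNReal.natCast_ne_top _))]
      · intro b hb
        rw [PMF.uniformOfFinset_apply_of_notMem _ hb, ite_self]
    · intro a ha
      rw [PMF.uniformOfFinset_apply_of_notMem _ ha, zero_mul]
  ext c
  rw [hsum]
  by_cases hc : c ∈ B
  · rw [PMF.uniformOfFinset_apply_of_mem _ hc]
    obtain ⟨x, hx, rfl⟩ := hg.surjOn hc
    rw [Finset.sum_eq_single_of_mem x hx, if_pos rfl]
    intro y hy hne
    exact if_neg fun e => hne (hg.injOn hy hx e.symm)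
  · rw [PMF.uniformOfFinset_apply_of_notMem _ hc]
    refine Finset.sum_eq_zero fun x hx => if_neg ?_
    rintro rfl
    exact hc (hg.mapsTo hx)

/-- No information is lost in a join: `w` is the parent of `v` in the new layer, and undoing the
swap returns the old layer. -/
theorem bijOn_joinLayer {V : Finset ℕ} {v : ℕ} (hv : v ∉ V) :
    Set.BijOn (fun x : Layers × (Fin 2 → ℕ) => fun m => joinLayer (x.1 m) v (x.2 m))
      (layersOn V ×ˢ Fintype.piFinset fun _ : Fin 2 => insert v V :
        Finset (Layers × (Fin 2 → ℕ)))
      (layersOn (insert v V)) := by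
  have hvV : v ∈ insert v V := Finset.mem_insert_self v V
  refine ⟨?_, ?_, ?_⟩
  · rintro ⟨c, w⟩ h
    simp only [Finset.coe_product, Set.mem_prod, Finset.mem_coe, mem_layersOn,
      Fintype.mem_piFinset] at h ⊢
    exact fun m => mul_mem_permsOn (permsOn_mono (Finset.subset_insert v V) (h.1 m))
      (swap_mem_permsOn (h.2 m) hvV)
  · rintro ⟨c, w⟩ h ⟨c', w'⟩ h' e
    simp only [Finset.coe_product, Set.mem_prod, Finset.mem_coe, mem_layersOn,
      Fintype.mem_piFinset] at h h'
    have hw : w = w' := by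
      funext m
      have e1 := joinLayer_apply_old (w := w m) (mem_permsOn.1 (h.1 m) v hv)
      have e2 := joinLayer_apply_old (w := w' m) (mem_permsOn.1 (h'.1 m) v hv)
      have e3 : joinLayer (c m) v (w m) = joinLayer (c' m) v (w' m) := congrFun e m
      rw [← e3] at e2
      exact (joinLayer (c m) v (w m)).injective (e1.trans e2.symm)
    subst hw
    have hc : c = c' := by
      funext m
      exact mul_right_cancel (congrFun e m : c m * swap (w m) v = c' m * swap (w m) v)
    rw [hc]
  · intro c hc
    rw [Finset.mem_coe, mem_layersOn] at hc
    refine ⟨(fun m => c m * swap ((c m).symm v) v, fun m => (c m).symm v), ?_, ?_⟩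
    · simp only [Finset.coe_product, Set.mem_prod, Finset.mem_coe, mem_layersOn,
        Fintype.mem_piFinset]
      have hw : ∀ m, (c m).symm v ∈ insert v V := fun m =>
        (apply_mem_of_mem_permsOn (inv_mem_permsOn (hc m))).2 hvV
      refine ⟨fun m => ?_, hw⟩
      have h1 := mem_permsOn.1 (mul_mem_permsOn (hc m) (swap_mem_permsOn (hw m) hvV))
      rw [mem_permsOn]
      intro x hx
      by_cases hxv : x = v
      · subst hxv; simp
      · exact h1 x (by simp [hxv, hx])
    · funext m
      simp [joinLayer, mul_assoc]

/-- The counterpart for leaves inserts `v` in front of its future child `w` instead of behind its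
parent. The child `w` is read off as the image of `v`. -/
theorem bijOn_swap_mul {V : Finset ℕ} {v : ℕ} (hv : v ∈ V) :
    Set.BijOn (fun x : Layers × (Fin 2 → ℕ) => fun m => swap v (x.2 m) * x.1 m)
      (layersOn (V.erase v) ×ˢ Fintype.piFinset fun _ : Fin 2 => V :
        Finset (Layers × (Fin 2 → ℕ)))
      (layersOn V) := by
  refine ⟨?_, ?_, ?_⟩
  · rintro ⟨c, w⟩ h
    simp only [Finset.coe_product, Set.mem_prod, Finset.mem_coe, mem_layersOn,
      Fintype.mem_piFinset] at h ⊢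
    exact fun m => mul_mem_permsOn (swap_mem_permsOn hv (h.2 m))
      (permsOn_mono (Finset.erase_subset v V) (h.1 m))
  · rintro ⟨c, w⟩ h ⟨c', w'⟩ h' e
    simp only [Finset.coe_product, Set.mem_prod, Finset.mem_coe, mem_layersOn,
      Fintype.mem_piFinset] at h h'
    have hw : w = w' := by
      funext m
      have e3 : swap v (w m) * c m = swap v (w' m) * c' m := congrFun e m
      have e4 := congrArg (fun σ : Perm ℕ => σ v) e3
      simpa [mem_permsOn.1 (h.1 m) v (Finset.notMem_erase v V),
        mem_permsOn.1 (h'.1 m) v (Finset.notMem_erase v V)] using e4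
    subst hw
    have hc : c = c' := by
      funext m
      exact mul_left_cancel (congrFun e m : swap v (w m) * c m = swap v (w m) * c' m)
    rw [hc]
  · intro c hc
    rw [Finset.mem_coe, mem_layersOn] at hc
    refine ⟨(fun m => swap v (c m v) * c m, fun m => c m v), ?_, ?_⟩
    · simp only [Finset.coe_product, Set.mem_prod, Finset.mem_coe, mem_layersOn,
        Fintype.mem_piFinset]
      have hw : ∀ m, c m v ∈ V := fun m => (apply_mem_of_mem_permsOn (hc m)).2 hv
      refine ⟨fun m => ?_, hw⟩
      have h1 := mem_permsOn.1 (mul_mem_permsOn (swap_mem_permsOn hv (hw m)) (hc m))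
      rw [mem_permsOn]
      intro x hx
      by_cases hxv : x = v
      · subst hxv; simp
      · exact h1 x fun hxV => hx (Finset.mem_erase.2 ⟨hxv, hxV⟩)
    · funext m
      simp [← mul_assoc]

theorem leaveLayer_swap_mul {c : Perm ℕ} {v w : ℕ} (h : c v = v) :
    leaveLayer (swap v w * c) v = c := by
  simp [leaveLayer, h, ← mul_assoc]

/-- After any sequence of joins and leaves, the layers are uniformly distributed. -/
theorem PairingLaw.eq_uniform {V : Finset ℕ} {μ : PMF Layers} (h : PairingLaw V μ) :
    source ∈ V ∧ μ = PMF.uniformOfFinset (layersOn V) (layersOn_nonempty V) := by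
  induction h with
  | init =>
    refine ⟨by simp, ?_⟩
    have h1 : layersOn {source} = {1} := by
      ext c
      rw [mem_layersOn, Finset.mem_singleton]
      constructor
      · intro h
        funext m
        ext x
        by_cases hx : x = source
        · have := (apply_mem_of_mem_permsOn (h m)).2 (Finset.mem_singleton.2 hx)
          rw [Finset.mem_singleton] at this
          rw [this, hx]; rfl
        · rw [mem_permsOn.1 (h m) x (by simpa using hx)]; rfl
      · rintro rfl m
        exact mem_permsOn.2 fun _ _ => rfl
    ext c
    by_cases hc : c = 1
    · rw [PMF.uniformOfFinset_apply_of_mem _ (by rw [h1, hc]; simp), h1, hc]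
      simp
    · rw [PMF.uniformOfFinset_apply_of_notMem _ (by rw [h1]; simpa using hc)]
      simp [PMF.pure_apply, hc]
  | join v hv h ih =>
    refine ⟨Finset.mem_insert_of_mem ih.1, ?_⟩
    rw [ih.2]
    exact uniformOfFinset_bind_map _ _ _ (fun (c : Layers) (w : Fin 2 → ℕ) m => joinLayer (c m) v (w m))
      (bijOn_joinLayer hv)
  | @leave V μ v hv hs h ih =>
    refine ⟨Finset.mem_erase.2 ⟨hs.symm, ih.1⟩, ?_⟩
    -- A uniform layer pair on `V` arises from one on `V.erase v` by random insertion of `v`; the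
    -- departure of `v` cancels the insertion whatever `w` was.
    rw [ih.2, ← uniformOfFinset_bind_map (layersOn_nonempty (V.erase v))
      (Fintype.piFinset_nonempty.2 fun _ => ⟨v, hv⟩) (layersOn_nonempty V)
      (fun (c : Layers) (w : Fin 2 → ℕ) m => swap v (w m) * c m) (bijOn_swap_mul hv), PMF.map_bind]
    ext c
    rw [PMF.bind_apply]
    have : ∀ a, PMF.uniformOfFinset (layersOn (V.erase v)) (layersOn_nonempty _) a *
        ((PMF.map (fun c m => leaveLayer (c m) v)
          (PMF.map (fun (w : Fin 2 → ℕ) m => swap v (w m) * a m)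
            (PMF.uniformOfFinset (Fintype.piFinset fun _ : Fin 2 => V)
              (Fintype.piFinset_nonempty.2 fun _ => ⟨v, hv⟩)))) c) =
        PMF.uniformOfFinset (layersOn (V.erase v)) (layersOn_nonempty _) a * PMF.pure a c := by
      intro a
      by_cases ha : a ∈ layersOn (V.erase v)
      · rw [PMF.map_comp]
        have hconst : (fun (c : Layers) m => leaveLayer (c m) v) ∘
            (fun (w : Fin 2 → ℕ) m => swap v (w m) * a m) = Function.const _ a := by
          funext w m
          exact leaveLayer_swap_mul
            (mem_permsOn.1 (mem_layersOn.1 ha m) v (Finset.notMem_erase v V))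
        rw [hconst, PMF.map_const]
      · rw [PMF.uniformOfFinset_apply_of_notMem _ ha, zero_mul, zero_mul]
    rw [tsum_congr this, ← PMF.bind_apply, PMF.bind_pure]

open Classical in
/-- The equally likely outcomes. -/
noncomputable def outcomesOn (V : Finset ℕ) : Finset Outcome :=
  (layersOn V ×ˢ V.powerset).image fun x => ⟨x.1, x.2⟩

theorem mem_outcomesOn {V : Finset ℕ} {ω : Outcome} :
    ω ∈ outcomesOn V ↔ (∀ m, ω.layers m ∈ permsOn V) ∧ ω.coins ⊆ V := by
  obtain ⟨c, T⟩ := ω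
  simp [outcomesOn, mem_layersOn]

theorem outcomesOn_nonempty (V : Finset ℕ) : (outcomesOn V).Nonempty :=
  ⟨⟨1, ∅⟩, mem_outcomesOn.2 ⟨fun _ => mem_permsOn.2 fun _ _ => rfl, Finset.empty_subset V⟩⟩

theorem outcomeLaw_eq_uniform {V : Finset ℕ} {μ : PMF Layers} (h : PairingLaw V μ) :
    outcomeLaw V μ = PMF.uniformOfFinset (outcomesOn V) (outcomesOn_nonempty V) := by
  rw [outcomeLaw, h.eq_uniform.2]
  refine uniformOfFinset_bind_map _ _ _ Outcome.mk ⟨?_, ?_, ?_⟩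
  · rintro ⟨c, T⟩ hx
    simpa [mem_outcomesOn, mem_layersOn] using hx
  · rintro ⟨c, T⟩ - ⟨c', T'⟩ - e
    simpa using e
  · rintro ⟨c, T⟩ hx
    exact ⟨(c, T), by simpa [mem_outcomesOn, mem_layersOn] using hx, rfl⟩

open Classical in
/-- Conditional probabilities under the law of the outcome are ratios of cardinalities. -/
theorem cond_outcomeLaw_ge {V : Finset ℕ} {μ : PMF Layers} (h : PairingLaw V μ)
    {S T : Set Outcome} {q : ℝ}
    (hpos : ({ω ∈ outcomesOn V | ω ∈ S} : Finset Outcome).Nonempty)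
    (hq : (({ω ∈ outcomesOn V | ω ∈ S ∧ ω ∉ T} : Finset Outcome).card : ℝ) ≤
      q * ({ω ∈ outcomesOn V | ω ∈ S} : Finset Outcome).card) :
    1 - q ≤ (ProbabilityTheory.cond (outcomeLaw V μ).toMeasure S).real T := by
  have hS : MeasurableSet S := trivial
  have hST : MeasurableSet (S ∩ T) := trivial
  rw [MeasureTheory.measureReal_def, ProbabilityTheory.cond_apply hS, outcomeLaw_eq_uniform h,
    PMF.toMeasure_uniformOfFinset_apply _ _ hS, PMF.toMeasure_uniformOfFinset_apply _ _ hST]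
  simp only [ENNReal.toReal_mul, ENNReal.toReal_inv, ENNReal.toReal_div, ENNReal.toReal_natCast]
  have hsplit := Finset.card_filter_add_card_filter_not (s := {ω ∈ outcomesOn V | ω ∈ S})
    (fun ω => ω ∈ T)
  simp only [Finset.filter_filter] at hsplit
  have hn : (0 : ℝ) < (outcomesOn V).card := by exact_mod_cast (outcomesOn_nonempty V).card_pos
  have hs : (0 : ℝ) < ({ω ∈ outcomesOn V | ω ∈ S} : Finset Outcome).card := by
    exact_mod_cast hpos.card_pos
  have hsplit' : (({ω ∈ outcomesOn V | ω ∈ S ∧ ω ∈ T} : Finset Outcome).card : ℝ) +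
      ({ω ∈ outcomesOn V | ω ∈ S ∧ ω ∉ T} : Finset Outcome).card =
      ({ω ∈ outcomesOn V | ω ∈ S} : Finset Outcome).card := by exact_mod_cast hsplit
  simp only [Set.mem_inter_iff]
  rw [inv_div, div_mul_div_comm, mul_comm, mul_div_mul_right _ _ hn.ne', le_div_iff₀ hs]
  linarith

open Classical in
theorem outcomeLaw_pos_iff {V : Finset ℕ} {μ : PMF Layers} (h : PairingLaw V μ)
    {S : Set Outcome} :
    0 < (outcomeLaw V μ).toMeasure S ↔
      ({ω ∈ outcomesOn V | ω ∈ S} : Finset Outcome).Nonempty := by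
  have hS : MeasurableSet S := trivial
  rw [outcomeLaw_eq_uniform h, PMF.toMeasure_uniformOfFinset_apply _ _ hS, ENNReal.div_pos_iff,
    ← Finset.card_pos]
  simp [Nat.pos_iff_ne_zero]

/-! ### Level sizes and flow counts from one depth to the next. -/

/-- The peers in depth `d`. -/
noncomputable def level (V : Finset ℕ) (D : ℕ) (ω : Outcome) (d : ℕ) : Finset ℕ :=
  {v ∈ V | (rfa ω D v).depth = d}

theorem mem_level {V : Finset ℕ} {D : ℕ} {ω : Outcome} {d v : ℕ} :
    v ∈ level V D ω d ↔ v ∈ V ∧ (rfa ω D v).depth = d := by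
  simp [level]

theorem card_level (V : Finset ℕ) (D : ℕ) (ω : Outcome) (d : ℕ) :
    (level V D ω d).card = levelCount V D ω d := rfl

/-- The peers in depth `d + 1` whose parent of smallest depth is their parent in layer `m`. -/
noncomputable def levelVia (V : Finset ℕ) (D : ℕ) (ω : Outcome) (d : ℕ) (m : Fin 2) : Finset ℕ :=
  {v ∈ level V D ω (d + 1) | bestParent ω (rfa ω D) v = m}

theorem mem_levelVia {V : Finset ℕ} {D : ℕ} {ω : Outcome} {d v : ℕ} {m : Fin 2} :
    v ∈ levelVia V D ω d m ↔
      v ∈ V ∧ (rfa ω D v).depth = (d + 1 : ℕ) ∧ bestParent ω (rfa ω D) v = m := by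
  simp [levelVia, mem_level, and_assoc]

/-- The peers in depth `d` that pass on their flow in layer `m`. -/
noncomputable def usedParents (V : Finset ℕ) (D : ℕ) (ω : Outcome) (d : ℕ) (m : Fin 2) :
    Finset ℕ :=
  (levelVia V D ω d m).map (ω.layers m).symm.toEmbedding

open Classical in
/-- The peers in depth `d` whose flow satisfies `Q`. -/
noncomputable def flowLevel (V : Finset ℕ) (D : ℕ) (ω : Outcome) (d : ℕ) (Q : ℕ → Prop) :
    Finset ℕ :=
  {v ∈ level V D ω d | Q (rfa ω D v).flow}

theorem mem_flowLevel {V : Finset ℕ} {D : ℕ} {ω : Outcome} {d v : ℕ} {Q : ℕ → Prop} :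
    v ∈ flowLevel V D ω d Q ↔ v ∈ level V D ω d ∧ Q (rfa ω D v).flow := by
  simp [flowLevel]

theorem card_flowLevel_eq_one (V : Finset ℕ) (D : ℕ) (ω : Outcome) (d : ℕ) :
    (flowLevel V D ω d (· = 1)).card = flowOneCount V D ω d := by
  classical
  rw [flowOneCount]
  congr 1
  ext v
  simp [mem_flowLevel, mem_level, and_assoc]

theorem card_flowLevel_add_not (V : Finset ℕ) (D : ℕ) (ω : Outcome) (d : ℕ) (Q : ℕ → Prop) :
    (flowLevel V D ω d Q).card + (flowLevel V D ω d fun x => ¬ Q x).card = levelCount V D ω d := by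
  classical
  rw [← card_level, ← Finset.card_filter_add_card_filter_not (s := level V D ω d)
    fun v => Q (rfa ω D v).flow]
  congr 2
  ext v
  simp [mem_flowLevel]

section
variable {V : Finset ℕ} {D : ℕ} {ω : Outcome} {d : ℕ}

theorem usedParents_subset (hD : 1 ≤ D) (hω : ω ∈ outcomesOn V) (m : Fin 2) :
    usedParents V D ω d m ⊆ level V D ω d := by
  intro u hu
  obtain ⟨v, hv, rfl⟩ := Finset.mem_map.1 hu
  obtain ⟨hvV, hvd, rfl⟩ := mem_levelVia.1 hv
  exact mem_level.2 ⟨(apply_mem_of_mem_permsOn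
    (inv_mem_permsOn ((mem_outcomesOn.1 hω).1 _))).2 hvV, depth_bestParent hD hvd⟩

/-- Each peer in depth `d + 1` is charged to the layer of its best parent, and within a layer
distinct peers have distinct parents. -/
theorem levelCount_succ_eq_sum (V : Finset ℕ) (D : ℕ) (ω : Outcome) (d : ℕ) :
    levelCount V D ω (d + 1) = ∑ m, (usedParents V D ω d m).card := by
  rw [← card_level, Finset.card_eq_sum_card_fiberwise (f := bestParent ω (rfa ω D))
    (t := Finset.univ) (fun _ _ => Finset.mem_coe.2 (Finset.mem_univ _))]
  exact Finset.sum_congr rfl fun m _ => (Finset.card_map _).symm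

theorem levelCount_succ_le (hD : 1 ≤ D) (hω : ω ∈ outcomesOn V) :
    levelCount V D ω (d + 1) ≤ 2 * levelCount V D ω d := by
  rw [levelCount_succ_eq_sum, Fin.sum_univ_two, ← card_level V D ω d]
  linarith [Finset.card_le_card (usedParents_subset (d := d) hD hω 0),
    Finset.card_le_card (usedParents_subset (d := d) hD hω 1)]

theorem level_zero (hD : 1 ≤ D) (hV : source ∈ V) : level V D ω 0 = {source} := by
  ext v
  rw [mem_level, Nat.cast_zero, depth_eq_zero_iff hD, Finset.mem_singleton]
  exact ⟨fun h => h.2, fun h => ⟨h ▸ hV, h⟩⟩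

theorem levelCount_zero (hD : 1 ≤ D) (hV : source ∈ V) : levelCount V D ω 0 = 1 := by
  rw [← card_level, level_zero hD hV, Finset.card_singleton]

theorem levelCount_le_two_pow (hD : 1 ≤ D) (hV : source ∈ V) (hω : ω ∈ outcomesOn V) (d : ℕ) :
    levelCount V D ω d ≤ 2 ^ d := by
  induction d with
  | zero => rw [levelCount_zero hD hV, pow_zero]
  | succ d ih =>
    have := levelCount_succ_le (d := d) hD hω
    rw [pow_succ]
    omega

variable {σ : Layers}

theorem depth_apply_of_mem_layersOn_level (hσ : σ ∈ layersOn (level V D ω d)) (m : Fin 2) (v : ℕ) :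
    (rfa ω D (σ m v)).depth = (rfa ω D v).depth := by
  have hm := mem_layersOn.1 hσ m
  by_cases hv : v ∈ level V D ω d
  · rw [(mem_level.1 hv).2, (mem_level.1 ((apply_mem_of_mem_permsOn hm).2 hv)).2]
  · rw [mem_permsOn.1 hm v hv]

theorem apply_eq_of_mem_layersOn_level (hσ : σ ∈ layersOn (level V D ω d)) (m : Fin 2) (v : ℕ)
    (hv : (rfa ω D v).depth ≠ d) : σ m v = v :=
  mem_permsOn.1 (mem_layersOn.1 hσ m) v fun h => hv (mem_level.1 h).2

theorem level_permuteParents (hD : 1 ≤ D) (hσ : σ ∈ layersOn (level V D ω d)) (j : ℕ) :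
    level V D (permuteParents σ ω) j = level V D ω j := by
  ext v
  rw [mem_level, mem_level, depth_permuteParents hD (depth_apply_of_mem_layersOn_level hσ)]

theorem levelCount_permuteParents (hD : 1 ≤ D) (hσ : σ ∈ layersOn (level V D ω d)) :
    levelCount V D (permuteParents σ ω) = levelCount V D ω := by
  funext j
  rw [← card_level, ← card_level, level_permuteParents hD hσ]

theorem permuteParents_mem_outcomesOn (hσ : σ ∈ layersOn (level V D ω d)) (hω : ω ∈ outcomesOn V) :
    permuteParents σ ω ∈ outcomesOn V := by
  rw [mem_outcomesOn] at *
  exact ⟨fun m => mul_mem_permsOn (hω.1 m) (inv_mem_permsOn (permsOn_mono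
    (Finset.filter_subset _ _) (mem_layersOn.1 hσ m))), hω.2⟩

theorem flowLevel_permuteParents (hD : 1 ≤ D) (hσ : σ ∈ layersOn (level V D ω d))
    (Q : ℕ → Prop) :
    flowLevel V D (permuteParents σ ω) d Q = flowLevel V D ω d Q := by
  ext v
  rw [mem_flowLevel, mem_flowLevel, level_permuteParents hD hσ]
  refine and_congr_right fun hv => ?_
  rw [flow_permuteParents hD (depth_apply_of_mem_layersOn_level hσ)
    (apply_eq_of_mem_layersOn_level hσ) le_rfl v (mem_level.1 hv).2]

/-- The sets of used parents belong to the unpermuted `ω`. As `σ` varies they stay fixed while their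
images sweep through the level, so the right-hand side is a sampling count, one independent sample
per layer. -/
theorem card_flowLevel_permuteParents (hD : 1 ≤ D) (hd : 1 ≤ d)
    (hω : ω ∈ outcomesOn V) (hσ : σ ∈ layersOn (level V D ω d)) (Q : ℕ → Prop) :
    (flowLevel V D (permuteParents σ ω) (d + 1) Q).card =
      ∑ m, ({u ∈ usedParents V D ω d m | σ m u ∈ flowLevel V D ω d Q} : Finset ℕ).card := by
  classical
  rw [Finset.card_eq_sum_card_fiberwise (f := bestParent ω (rfa ω D))
    (t := Finset.univ) (fun _ _ => Finset.mem_coe.2 (Finset.mem_univ _))]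
  refine Finset.sum_congr rfl fun m _ => ?_
  rw [usedParents, Finset.filter_map, Finset.card_map]
  congr 1
  ext v
  simp only [Finset.mem_filter, mem_flowLevel, level_permuteParents hD hσ, mem_level, mem_levelVia,
    Function.comp_apply, Equiv.coe_toEmbedding]
  constructor
  · rintro ⟨⟨⟨h1, h2⟩, h3⟩, rfl⟩
    rw [flow_permuteParents_succ hd hD (depth_apply_of_mem_layersOn_level hσ)
      (apply_eq_of_mem_layersOn_level hσ) h2] at h3
    have hp := usedParents_subset hD hω _
      (Finset.mem_map_of_mem (ω.layers _).symm.toEmbedding (mem_levelVia.2 ⟨h1, h2, rfl⟩))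
    exact ⟨⟨h1, h2, rfl⟩,
      mem_level.1 ((apply_mem_of_mem_permsOn (mem_layersOn.1 hσ _)).2 hp), h3⟩
  · rintro ⟨⟨h1, h2, rfl⟩, -, h3⟩
    refine ⟨⟨⟨h1, h2⟩, ?_⟩, rfl⟩
    rwa [flow_permuteParents_succ hd hD (depth_apply_of_mem_layersOn_level hσ)
      (apply_eq_of_mem_layersOn_level hσ) h2]

theorem permuteParents_one (ω : Outcome) : permuteParents 1 ω = ω := by
  simp [permuteParents]

theorem card_flowLevel_succ (hD : 1 ≤ D) (hd : 1 ≤ d) (hω : ω ∈ outcomesOn V) (Q : ℕ → Prop) :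
    (flowLevel V D ω (d + 1) Q).card =
      ∑ m, ({u ∈ usedParents V D ω d m | u ∈ flowLevel V D ω d Q} : Finset ℕ).card := by
  have h1 : (1 : Layers) ∈ layersOn (level V D ω d) :=
    mem_layersOn.2 fun _ => mem_permsOn.2 fun _ _ => rfl
  have h := card_flowLevel_permuteParents hD hd hω h1 Q
  rw [permuteParents_one] at h
  exact h

/-- If the level doubles, every peer in depth `d` passes on its flow in both layers. -/
theorem flowOneCount_succ_of_full (hD : 1 ≤ D) (hd : 1 ≤ d) (hω : ω ∈ outcomesOn V)
    (h : 2 * levelCount V D ω d ≤ levelCount V D ω (d + 1)) :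
    flowOneCount V D ω (d + 1) = 2 * flowOneCount V D ω d := by
  rw [levelCount_succ_eq_sum, Fin.sum_univ_two, ← card_level V D ω d] at h
  have h0 := usedParents_subset (d := d) hD hω 0
  have h1 := usedParents_subset (d := d) hD hω 1
  have c0 := Finset.card_le_card h0
  have c1 := Finset.card_le_card h1
  have e0 := Finset.eq_of_subset_of_card_le h0 (by omega)
  have e1 := Finset.eq_of_subset_of_card_le h1 (by omega)
  have e : ({u ∈ level V D ω d | u ∈ flowLevel V D ω d (· = 1)} : Finset ℕ) =
      flowLevel V D ω d (· = 1) := by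
    ext u
    simp only [Finset.mem_filter, mem_flowLevel]
    tauto
  rw [← card_flowLevel_eq_one, card_flowLevel_succ hD hd hω, Fin.sum_univ_two, e0, e1, e,
    card_flowLevel_eq_one, two_mul]

/-- Each layer gives the source at most one child in depth `1`. If there are two such peers, exactly
one is reached through the first layer. -/
theorem flowOneCount_one (hD : 1 ≤ D) (hV : source ∈ V) (hω : ω ∈ outcomesOn V)
    (h : 2 ≤ levelCount V D ω 1) : flowOneCount V D ω 1 = 1 := by
  have hs := levelCount_succ_eq_sum V D ω 0
  rw [Fin.sum_univ_two, zero_add] at hs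
  have hle := fun m => Finset.card_le_card (usedParents_subset (d := 0) hD hω m)
  simp only [level_zero hD hV, Finset.card_singleton] at hle
  have hvia : (levelVia V D ω 0 0).card = 1 := by
    have := hle 0
    have := hle 1
    rw [← Finset.card_map (ω.layers 0).symm.toEmbedding]
    change (usedParents V D ω 0 0).card = 1
    omega
  rw [← card_flowLevel_eq_one]
  refine Eq.trans (congrArg Finset.card ?_) hvia
  ext v
  rw [mem_flowLevel, mem_level, mem_levelVia, and_assoc, zero_add, Nat.cast_one]
  refine and_congr_right fun _ => and_congr_right fun hv => ?_
  rw [flow_eq_bestParent hD hv]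
  omega

theorem sum_permsOn_exp_le {L X B : Finset ℕ} (hX : X ⊆ L) (hB : B ⊆ L) {s : ℝ}
    (hs0 : 0 ≤ s) (hs1 : s ≤ 1) :
    ∑ τ ∈ permsOn L, Real.exp (s * ({u ∈ B | τ u ∈ X} : Finset ℕ).card) ≤
      ((permsOn L).card : ℝ) * Real.exp (B.card * ((X.card : ℝ) / L.card * s + s ^ 2)) := by
  have hmap : ∀ Y ⊆ L, (Y.subtype (· ∈ L)).card = Y.card := fun Y hY => by
    rw [Finset.card_subtype, Finset.filter_true_of_mem fun x hx => hY hx]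
  have h := sum_perm_exp_le (X.subtype (· ∈ L)) (B.subtype (· ∈ L)) hs0 hs1
  rw [hmap X hX, hmap B hB, Fintype.card_coe] at h
  rw [permsOn, Finset.card_map, Finset.card_univ, Finset.sum_map]
  refine le_of_eq_of_le (Finset.sum_congr rfl fun τ _ => ?_) h
  congr 3
  rw [← Finset.card_map (Function.Embedding.subtype (· ∈ L))]
  congr 1
  ext u
  simp only [Finset.mem_filter, Finset.mem_map, Finset.mem_subtype,
    Function.Embedding.coeFn_mk, Function.Embedding.subtype_apply, Subtype.exists,
    exists_and_right, exists_eq_right]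
  constructor
  · rintro ⟨h1, h2⟩
    rw [Perm.ofSubtype_apply_of_mem τ (hB h1)] at h2
    exact ⟨hB h1, h1, h2⟩
  · rintro ⟨h0, h1, h2⟩
    rw [Perm.ofSubtype_apply_of_mem τ h0]
    exact ⟨h1, h2⟩

/-- Permuting the parents in depth `d` at random mixes the flows in depth `d + 1`. -/
theorem sum_exp_card_flowLevel_le (hD : 1 ≤ D) (hd : 1 ≤ d) (hω : ω ∈ outcomesOn V)
    (Q : ℕ → Prop) {s : ℝ} (hs0 : 0 ≤ s) (hs1 : s ≤ 1) :
    ∑ σ ∈ layersOn (level V D ω d),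
        Real.exp (s * (flowLevel V D (permuteParents σ ω) (d + 1) Q).card) ≤
      ((layersOn (level V D ω d)).card : ℝ) *
        Real.exp (levelCount V D ω (d + 1) *
          (((flowLevel V D ω d Q).card : ℝ) / levelCount V D ω d * s + s ^ 2)) := by
  have hX : flowLevel V D ω d Q ⊆ level V D ω d := fun v hv => (mem_flowLevel.1 hv).1
  have hterm : ∀ σ ∈ layersOn (level V D ω d),
      Real.exp (s * (flowLevel V D (permuteParents σ ω) (d + 1) Q).card) =
        ∏ m, Real.exp (s *
          ({u ∈ usedParents V D ω d m | σ m u ∈ flowLevel V D ω d Q} : Finset ℕ).card) := by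
    intro σ hσ
    rw [card_flowLevel_permuteParents hD hd hω hσ, Nat.cast_sum, Finset.mul_sum, Real.exp_sum]
  -- The two layers are permuted independently, so the sum over pairs factors into a product.
  rw [Finset.sum_congr rfl hterm, layersOn,
    ← Finset.prod_univ_sum (fun _ => permsOn (level V D ω d)) (fun m τ => Real.exp (s *
      ({u ∈ usedParents V D ω d m | τ u ∈ flowLevel V D ω d Q} : Finset ℕ).card))]
  refine (Finset.prod_le_prod (fun m _ => Finset.sum_nonneg fun τ _ => (Real.exp_pos _).le)
    fun m _ => sum_permsOn_exp_le hX (usedParents_subset hD hω m) hs0 hs1).trans_eq ?_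
  rw [Finset.prod_mul_distrib, ← Real.exp_sum, ← Finset.sum_mul, Fintype.card_piFinset,
    levelCount_succ_eq_sum, ← card_level V D ω d]
  push_cast
  rfl

end

/-! ### Concentration between consecutive depths. -/

theorem permuteParents_inv_permuteParents (σ : Layers) (ω : Outcome) :
    permuteParents σ⁻¹ (permuteParents σ ω) = ω := by
  simp [permuteParents]

theorem permuteParents_permuteParents_inv (σ : Layers) (ω : Outcome) :
    permuteParents σ (permuteParents σ⁻¹ ω) = ω := by
  simp [permuteParents]

theorem inv_mem_layersOn {L : Finset ℕ} {σ : Layers} (h : σ ∈ layersOn L) : σ⁻¹ ∈ layersOn L :=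
  mem_layersOn.2 fun m => inv_mem_permsOn (mem_layersOn.1 h m)

/-- The exponential weight of an excess, by more than `δ`, of the proportion of flows with `Q` in
depth `d + 1` over the one in depth `d`. -/
noncomputable def excessWeight (V : Finset ℕ) (D d : ℕ) (Q : ℕ → Prop) (s δ : ℝ) (ω : Outcome) :
    ℝ :=
  Real.exp (s * ((flowLevel V D ω (d + 1) Q).card -
    (((flowLevel V D ω d Q).card : ℝ) / levelCount V D ω d + δ) * levelCount V D ω (d + 1)))

section
variable {V : Finset ℕ} {D d : ℕ}

/-- Only the flow count in depth `d + 1` varies with `σ`; the threshold is constant. With `n` peers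
in depth `d + 1`, the exponent becomes `n (s² - δ s)`, which `s = δ / 2` minimizes; `δ ≤ 2` ensures
`s ≤ 1`. -/
theorem sum_excessWeight_permuteParents_le (hD : 1 ≤ D) (hd : 1 ≤ d) {ω : Outcome}
    (hω : ω ∈ outcomesOn V) (Q : ℕ → Prop) {θ δ : ℝ} (hδ0 : 0 ≤ δ) (hδ2 : δ ≤ 2)
    (hθ : θ ≤ levelCount V D ω (d + 1)) :
    ∑ σ ∈ layersOn (level V D ω d), excessWeight V D d Q (δ / 2) δ (permuteParents σ ω) ≤
      ((layersOn (level V D ω d)).card : ℝ) * Real.exp (-(θ * δ ^ 2 / 4)) := by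
  set r : ℝ := ((flowLevel V D ω d Q).card : ℝ) / levelCount V D ω d with hr
  set n : ℝ := ((levelCount V D ω (d + 1) : ℕ) : ℝ) with hn
  have hterm : ∀ σ ∈ layersOn (level V D ω d),
      excessWeight V D d Q (δ / 2) δ (permuteParents σ ω) =
        Real.exp (δ / 2 * (flowLevel V D (permuteParents σ ω) (d + 1) Q).card) *
          Real.exp (-(δ / 2 * ((r + δ) * n))) := by
    intro σ hσ
    rw [excessWeight, flowLevel_permuteParents hD hσ, levelCount_permuteParents hD hσ,
      ← Real.exp_add]
    congr 1
    ring
  rw [Finset.sum_congr rfl hterm, ← Finset.sum_mul]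
  calc _ ≤ ((layersOn (level V D ω d)).card : ℝ) *
        Real.exp (n * (r * (δ / 2) + (δ / 2) ^ 2)) * Real.exp (-(δ / 2 * ((r + δ) * n))) :=
        mul_le_mul_of_nonneg_right
          (sum_exp_card_flowLevel_le hD hd hω Q (by positivity) (by linarith)) (Real.exp_pos _).le
    _ = ((layersOn (level V D ω d)).card : ℝ) * Real.exp (-(n * δ ^ 2 / 4)) := by
        rw [mul_assoc, ← Real.exp_add]
        congr 2
        ring
    _ ≤ _ := by gcongr

/-- If the set `E` of outcomes is invariant under permutations of the parents in depth `d`, then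
the proportion of flows with `Q` rarely increases by `δ` between depths `d` and `d + 1`. -/
theorem card_flow_excess_le (hD : 1 ≤ D) (hd : 1 ≤ d) {E : Finset Outcome}
    (hE : E ⊆ outcomesOn V)
    (hinv : ∀ ω ∈ E, ∀ σ ∈ layersOn (level V D ω d), permuteParents σ ω ∈ E)
    (Q : ℕ → Prop) {θ δ : ℝ} (hδ0 : 0 ≤ δ) (hδ2 : δ ≤ 2)
    (hθ : ∀ ω ∈ E, θ ≤ levelCount V D ω (d + 1)) {B : Finset Outcome} (hBE : B ⊆ E)
    (hB : ∀ ω ∈ B, (((flowLevel V D ω d Q).card : ℝ) / levelCount V D ω d + δ) *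
      levelCount V D ω (d + 1) ≤ (flowLevel V D ω (d + 1) Q).card) :
    (B.card : ℝ) ≤ Real.exp (-(θ * δ ^ 2 / 4)) * E.card := by
  classical
  set w := excessWeight V D d Q (δ / 2) δ with hw
  set q := Real.exp (-(θ * δ ^ 2 / 4)) with hq
  -- Markov's inequality: on `B` the excess is nonnegative, so the total weight bounds the size of
  -- `B`.
  have hwB : ∀ ω ∈ B, 1 ≤ w ω := fun ω hω =>
    Real.one_le_exp (mul_nonneg (by positivity) (by linarith [hB ω hω]))
  have hw0 : ∀ ω, 0 ≤ w ω := fun ω => (Real.exp_pos _).le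
  -- The group that permutes the parents depends on `ω` through its level. Fixing the level set `L`
  -- makes it one group acting on the whole fibre, so the weight may be averaged over the group.
  have hfiber : ∀ L ∈ V.powerset, ∑ ω ∈ E with level V D ω d = L, w ω ≤
      ∑ ω ∈ E with level V D ω d = L, q := by
    intro L _
    have hinvL : ∀ σ ∈ layersOn L, ∑ ω ∈ E with level V D ω d = L, w (permuteParents σ ω) =
        ∑ ω ∈ E with level V D ω d = L, w ω := by
      have hmap : ∀ σ ∈ layersOn L, ∀ ω ∈ ({ω ∈ E | level V D ω d = L} : Finset Outcome),
          permuteParents σ ω ∈ ({ω ∈ E | level V D ω d = L} : Finset Outcome) := by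
        intro σ hσ ω hω
        obtain ⟨hωE, rfl⟩ := Finset.mem_filter.1 hω
        exact Finset.mem_filter.2 ⟨hinv ω hωE σ hσ, level_permuteParents hD hσ d⟩
      intro σ hσ
      exact Finset.sum_nbij' (permuteParents σ) (permuteParents σ⁻¹) (hmap σ hσ)
        (hmap _ (inv_mem_layersOn hσ)) (fun ω _ => permuteParents_inv_permuteParents σ ω)
        (fun ω _ => permuteParents_permuteParents_inv σ ω) fun _ _ => rfl
    have hG : (0 : ℝ) < (layersOn L).card := by exact_mod_cast (layersOn_nonempty L).card_pos
    refine le_of_mul_le_mul_left ?_ hG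
    rw [← nsmul_eq_mul, ← Finset.sum_const, ← Finset.sum_congr rfl hinvL, Finset.sum_comm,
      Finset.mul_sum]
    refine Finset.sum_le_sum fun ω hω => ?_
    obtain ⟨hωE, rfl⟩ := Finset.mem_filter.1 hω
    exact sum_excessWeight_permuteParents_le hD hd (hE hωE) Q hδ0 hδ2 (hθ ω hωE)
  have hmaps : ∀ ω ∈ E, level V D ω d ∈ V.powerset := fun ω _ =>
    Finset.mem_powerset.2 (Finset.filter_subset _ _)
  calc (B.card : ℝ) = ∑ ω ∈ B, (1 : ℝ) := by simp
    _ ≤ ∑ ω ∈ B, w ω := Finset.sum_le_sum hwB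
    _ ≤ ∑ ω ∈ E, w ω := Finset.sum_le_sum_of_subset_of_nonneg hBE fun ω _ _ => hw0 ω
    _ = ∑ L ∈ V.powerset, ∑ ω ∈ E with level V D ω d = L, w ω :=
        (Finset.sum_fiberwise_of_maps_to hmaps _).symm
    _ ≤ ∑ L ∈ V.powerset, ∑ ω ∈ E with level V D ω d = L, q := Finset.sum_le_sum hfiber
    _ = ∑ ω ∈ E, q := Finset.sum_fiberwise_of_maps_to hmaps _
    _ = q * E.card := by rw [Finset.sum_const, nsmul_eq_mul, mul_comm]

open Classical in
/-- The proportion of flow-1 peers rarely changes by `δ` between depths `d` and `d + 1`. -/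
theorem card_flowOne_deviation_le (hD : 1 ≤ D) (hd : 1 ≤ d) {E : Finset Outcome}
    (hE : E ⊆ outcomesOn V)
    (hinv : ∀ ω ∈ E, ∀ σ ∈ layersOn (level V D ω d), permuteParents σ ω ∈ E)
    {θ δ : ℝ} (hδ0 : 0 ≤ δ) (hδ2 : δ ≤ 2) (hθ0 : 0 < θ)
    (hθ : ∀ ω ∈ E, θ ≤ levelCount V D ω (d + 1)) :
    (({ω ∈ E | δ < |(flowOneCount V D ω (d + 1) : ℝ) / levelCount V D ω (d + 1) -
      (flowOneCount V D ω d : ℝ) / levelCount V D ω d|} : Finset Outcome).card : ℝ) ≤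
      2 * Real.exp (-(θ * δ ^ 2 / 4)) * E.card := by
  set B : (ℕ → Prop) → Finset Outcome := fun Q => {ω ∈ E |
    (((flowLevel V D ω d Q).card : ℝ) / levelCount V D ω d + δ) *
      levelCount V D ω (d + 1) ≤ (flowLevel V D ω (d + 1) Q).card} with hBdef
  have hB : ∀ Q, ((B Q).card : ℝ) ≤ Real.exp (-(θ * δ ^ 2 / 4)) * E.card := fun Q =>
    card_flow_excess_le hD hd hE hinv Q hδ0 hδ2 hθ (Finset.filter_subset _ _)
      fun ω hω => (Finset.mem_filter.1 hω).2
  -- A deficit of flow 1 is an excess of the complementary flows, so the one-sided bound is used for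
  -- both predicates.
  have hsub : ({ω ∈ E | δ < |(flowOneCount V D ω (d + 1) : ℝ) / levelCount V D ω (d + 1) -
      (flowOneCount V D ω d : ℝ) / levelCount V D ω d|} : Finset Outcome) ⊆
      B (· = 1) ∪ B (fun x => ¬ x = 1) := by
    intro ω hω
    obtain ⟨hωE, hdev⟩ := Finset.mem_filter.1 hω
    rw [Finset.mem_union, Finset.mem_filter, Finset.mem_filter]
    have hpos : (0 : ℝ) < levelCount V D ω (d + 1) := hθ0.trans_le (hθ ω hωE)
    have hpos' : (0 : ℝ) < levelCount V D ω d := by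
      have h1 := levelCount_succ_le (d := d) hD (hE hωE)
      have h2 : 0 < levelCount V D ω (d + 1) := by exact_mod_cast hpos
      have : 0 < levelCount V D ω d := by omega
      exact_mod_cast this
    have e1 := card_flowLevel_add_not V D ω d (· = 1)
    have e2 := card_flowLevel_add_not V D ω (d + 1) (· = 1)
    rw [← card_flowLevel_eq_one, ← card_flowLevel_eq_one] at hdev
    have e1' : ((flowLevel V D ω d (· = 1)).card : ℝ) +
      (flowLevel V D ω d fun x => ¬ x = 1).card = levelCount V D ω d := by exact_mod_cast e1
    have e2' : ((flowLevel V D ω (d + 1) (· = 1)).card : ℝ) +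
      (flowLevel V D ω (d + 1) fun x => ¬ x = 1).card = levelCount V D ω (d + 1) := by
      exact_mod_cast e2
    rcases lt_abs.1 hdev with h | h
    · left
      refine ⟨hωE, ?_⟩
      rw [← le_div_iff₀ hpos]
      linarith
    · right
      refine ⟨hωE, ?_⟩
      rw [← le_div_iff₀ hpos, eq_sub_of_add_eq' e1', eq_sub_of_add_eq' e2', sub_div, sub_div,
        div_self hpos.ne', div_self hpos'.ne']
      linarith
  calc _ ≤ (((B (· = 1) ∪ B (fun x => ¬ x = 1)).card : ℕ) : ℝ) := by
        exact_mod_cast Finset.card_le_card hsub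
    _ ≤ (B (· = 1)).card + (B (fun x => ¬ x = 1)).card := by
        exact_mod_cast Finset.card_union_le _ _
    _ ≤ _ := by linarith [hB (· = 1), hB (fun x => ¬ x = 1)]

end

/-! ### A complete binary tree as a possible outcome. -/

section
variable {V : Finset ℕ} {D : ℕ}

theorem exists_injective_labelling {n : ℕ} (hV : source ∈ V) (hn : n ≤ V.card) :
    ∃ f : ℕ → ℕ, f 1 = source ∧ (∀ i, 1 ≤ i → i ≤ n → f i ∈ V) ∧
      ∀ i j, 1 ≤ i → i ≤ n → 1 ≤ j → j ≤ n → f i = f j → i = j := by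
  have h1 : 0 < V.card := Finset.card_pos.2 ⟨_, hV⟩
  obtain ⟨g, hg⟩ := Finset.exists_equiv_extend_of_card_eq (α := Fin V.card) (t := V)
    (Fintype.card_fin _) (s := {⟨0, h1⟩}) (f := fun _ => source)
    (by simpa using hV) (by simp)
  refine ⟨fun i => if h : i - 1 < V.card then g ⟨i - 1, h⟩ else 0, ?_, ?_, ?_⟩
  · simp only [Nat.sub_self, dif_pos h1]
    exact hg _ (by simp)
  · intro i hi hin
    simp only [dif_pos (show i - 1 < V.card by omega)]
    exact (g _).2
  · intro i j hi hin hj hjn e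
    simp only [dif_pos (show i - 1 < V.card by omega), dif_pos (show j - 1 < V.card by omega)] at e
    have := g.injective (Subtype.ext e)
    simp only [Fin.mk.injEq] at this
    omega

/-- An injective partial map between peers extends to a layer. -/
theorem exists_mem_permsOn_extend {ι : Type*} [DecidableEq ι] (I : Finset ι) (f g : ι → ℕ)
    (hfV : ∀ i ∈ I, f i ∈ V) (hgV : ∀ i ∈ I, g i ∈ V)
    (hf : Set.InjOn f I) (hg : Set.InjOn g I) :
    ∃ c ∈ permsOn V, ∀ i ∈ I, c (f i) = g i := by
  classical
  rcases I.eq_empty_or_nonempty with rfl | ⟨i₀, hi₀⟩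
  · exact ⟨1, mem_permsOn.2 fun _ _ => rfl, by simp⟩
  have : Nonempty ι := ⟨i₀⟩
  have hinv : ∀ i ∈ I, Function.invFunOn f I (f i) = i := fun i hi => hf.leftInvOn_invFunOn hi
  obtain ⟨e, he⟩ := Finset.exists_equiv_extend_of_card_eq (α := V) (t := V) (Fintype.card_coe V)
    (s := (I.image f).subtype (· ∈ V)) (f := fun x => g (Function.invFunOn f I x)) (by
      intro y hy
      obtain ⟨x, hx, rfl⟩ := Finset.mem_image.1 hy
      obtain ⟨i, hi, hix⟩ := Finset.mem_image.1 (Finset.mem_subtype.1 hx)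
      rw [← hix, hinv i hi]
      exact hgV i hi) (by
      intro x hx y hy e
      obtain ⟨i, hi, hix⟩ := Finset.mem_image.1 (Finset.mem_subtype.1 hx)
      obtain ⟨j, hj, hjy⟩ := Finset.mem_image.1 (Finset.mem_subtype.1 hy)
      simp only [← hix, ← hjy, hinv i hi, hinv j hj] at e
      apply Subtype.ext
      rw [← hix, ← hjy, hg hi hj e])
  refine ⟨Perm.ofSubtype e, Finset.mem_map_of_mem _ (Finset.mem_univ e), fun i hi => ?_⟩
  rw [Perm.ofSubtype_apply_of_mem e (hfV i hi),
    he ⟨f i, hfV i hi⟩ (Finset.mem_subtype.2 (Finset.mem_image_of_mem f hi))]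
  simp only [hinv i hi]

/-- If there are enough peers, the levels can form a complete binary tree. -/
theorem exists_levelCount_eq_two_pow (hD : 1 ≤ D) (hV : source ∈ V) (hN : 2 ^ (D + 1) ≤ V.card) :
    ∃ ω ∈ outcomesOn V, ∀ d ≤ D, levelCount V D ω d = 2 ^ d := by
  obtain ⟨f, hf1, hfV, hfinj⟩ := exists_injective_labelling hV hN
  -- Heap numbering: node `i` has the children `2 * i` and `2 * i + 1`, one per layer, and depth `j`
  -- holds the indices from `2 ^ j` to `2 ^ (j + 1) - 1`.
  have hchild : ∀ m : Fin 2, ∃ c ∈ permsOn V, ∀ i ∈ Finset.Ico 1 (2 ^ D), c (f i) =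
      f (2 * i + m) := by
    intro m
    rw [pow_succ] at hfV hfinj
    refine exists_mem_permsOn_extend _ _ _ ?_ ?_ ?_ ?_
    · intro i hi
      rw [Finset.mem_Ico] at hi
      exact hfV i (by omega) (by omega)
    · intro i hi
      rw [Finset.mem_Ico] at hi
      exact hfV _ (by omega) (by omega)
    · intro i hi j hj e
      rw [Finset.mem_coe, Finset.mem_Ico] at hi hj
      exact hfinj i j (by omega) (by omega) (by omega) (by omega) e
    · intro i hi j hj e
      rw [Finset.mem_coe, Finset.mem_Ico] at hi hj
      have := hfinj _ _ (by omega) (by omega) (by omega) (by omega) e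
      omega
  choose c hcV hc using hchild
  set ω : Outcome := ⟨c, ∅⟩ with hω
  have hmem : ω ∈ outcomesOn V := mem_outcomesOn.2 ⟨hcV, Finset.empty_subset V⟩
  have hpar : ∀ (m : Fin 2) (i : ℕ), 1 ≤ i → i < 2 ^ D → parent ω m (f (2 * i + m)) = f i := by
    intro m i hi hi'
    rw [parent, Equiv.symm_apply_eq]
    exact (hc m i (Finset.mem_Ico.2 ⟨hi, hi'⟩)).symm
  have hlevel : ∀ d ≤ D, ∀ j ≤ d, ∀ v, (rfa ω D v).depth = j ↔
      ∃ i, 2 ^ j ≤ i ∧ i < 2 ^ (j + 1) ∧ v = f i := by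
    intro d
    induction d with
    | zero =>
      intro _ j hj v
      obtain rfl : j = 0 := by omega
      rw [Nat.cast_zero, depth_eq_zero_iff hD]
      constructor
      · rintro rfl
        exact ⟨1, by norm_num, by norm_num, hf1.symm⟩
      · rintro ⟨i, hi, hi', rfl⟩
        obtain rfl : i = 1 := by
          rw [pow_zero] at hi
          rw [zero_add, pow_one] at hi'
          omega
        exact hf1
    | succ d ih =>
      intro hd j hj v
      rcases Nat.lt_or_ge j (d + 1) with h | h
      · exact ih (by omega) j (by omega) v
      obtain rfl : j = d + 1 := by omega
      have ih' := ih (by omega)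
      have hpow : 2 ^ (d + 1) ≤ 2 ^ D := Nat.pow_le_pow_right (by norm_num) hd
      have hpow0 : 1 ≤ 2 ^ d := Nat.one_le_two_pow
      have e1 : 2 ^ (d + 1) = 2 * 2 ^ d := by ring
      have e2 : 2 ^ (d + 1 + 1) = 4 * 2 ^ d := by ring
      have e3 : 2 ^ (D + 1) = 2 * 2 ^ D := by ring
      rw [depth_eq_succ_iff hD (by omega), e1, e2]
      constructor
      -- The other parent of a node is arbitrary, but it opens no shortcut: both children of every
      -- node above depth `D` are prescribed.
      · rintro ⟨⟨m, hm⟩, -⟩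
        obtain ⟨i, hi, hi', hmi⟩ := (ih' d le_rfl _).1 hm
        rw [parent, Equiv.symm_apply_eq] at hmi
        refine ⟨2 * i + m, by omega, by omega, ?_⟩
        rw [hmi]
        exact hc m i (Finset.mem_Ico.2 ⟨by omega, by omega⟩)
      · rintro ⟨i, hi, hi', rfl⟩
        refine ⟨⟨⟨i % 2, Nat.mod_lt _ (by norm_num)⟩, ?_⟩, fun j hj e => ?_⟩
        · rw [ih' d le_rfl]
          refine ⟨i / 2, by omega, by omega, ?_⟩
          have := hpar ⟨i % 2, Nat.mod_lt _ (by norm_num)⟩ (i / 2) (by omega) (by omega)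
          rwa [show 2 * (i / 2) + i % 2 = i from Nat.div_add_mod i 2] at this
        · obtain ⟨i', h1, h2, h3⟩ := (ih' j hj _).1 e
          have hj' : 2 ^ (j + 1) ≤ 2 ^ (d + 1) := Nat.pow_le_pow_right (by norm_num) (by omega)
          have hj0 : 1 ≤ 2 ^ j := Nat.one_le_two_pow
          have := hfinj i i' (by omega) (by omega) (by omega) (by omega) h3
          omega
  refine ⟨ω, hmem, fun d hd => ?_⟩
  have hpow : 2 ^ d ≤ 2 ^ D := Nat.pow_le_pow_right (by norm_num) hd
  have hpow0 : 1 ≤ 2 ^ d := Nat.one_le_two_pow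
  have e1 : 2 ^ (d + 1) = 2 * 2 ^ d := by ring
  have e3 : 2 ^ (D + 1) = 2 * 2 ^ D := by ring
  rw [← card_level]
  have : level V D ω d = (Finset.Ico (2 ^ d) (2 ^ (d + 1))).image f := by
    ext v
    rw [mem_level, hlevel D le_rfl d hd, Finset.mem_image]
    constructor
    · rintro ⟨-, i, h1, h2, rfl⟩
      exact ⟨i, Finset.mem_Ico.2 ⟨h1, h2⟩, rfl⟩
    · rintro ⟨i, hi, rfl⟩
      rw [Finset.mem_Ico] at hi
      exact ⟨hfV i (by omega) (by omega), i, hi.1, hi.2, rfl⟩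
  rw [this, Finset.card_image_of_injOn, Nat.card_Ico, e1]
  · omega
  · intro i hi j hj e
    rw [Finset.mem_coe, Finset.mem_Ico] at hi hj
    exact hfinj i j (by omega) (by omega) (by omega) (by omega) e

end

/-! ### Bounds for large `N` and consequences of near-binary growth. -/

theorem eventually_dStar {c : ℝ} (hc0 : 0 < c) (hc1 : c < 1) :
    ∀ᶠ N : ℕ in atTop, 1 ≤ dStar c N ∧ 2 ^ (dStar c N + 4) ≤ N := by
  have hlog : Tendsto (fun N : ℕ => Real.log N) atTop atTop :=
    Real.tendsto_log_atTop.comp tendsto_natCast_atTop_atTop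
  have hpow : Tendsto (fun N : ℕ => Real.log N ^ c) atTop atTop :=
    (tendsto_rpow_atTop hc0).comp hlog
  -- Of the factor `32`, a factor `2` pays for the ceiling in `dStar` and `16` is the margin `2 ^
  -- 4`.
  filter_upwards [hlog.eventually_ge_atTop 1, hpow.eventually_ge_atTop 32,
    eventually_ge_atTop 1] with N h1 h32 hN
  have hN0 : (0 : ℝ) < N := by exact_mod_cast hN
  have hpos : 0 < Real.log N ^ c := by linarith
  have hlt : Real.log N ^ c < N := by
    calc Real.log N ^ c ≤ Real.log N ^ (1 : ℝ) := Real.rpow_le_rpow_of_exponent_le h1 hc1.le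
      _ = Real.log N := Real.rpow_one _
      _ < N := by linarith [Real.log_le_sub_one_of_pos hN0]
  set x : ℝ := N / Real.log N ^ c with hx
  have hx1 : 1 < x := (one_lt_div hpos).2 hlt
  have hlogx : 0 < Real.logb 2 x := Real.logb_pos (by norm_num) hx1
  refine ⟨Nat.ceil_pos.2 hlogx, ?_⟩
  have hD : (dStar c N : ℝ) < Real.logb 2 x + 1 := Nat.ceil_lt_add_one hlogx.le
  have h2D : (2 : ℝ) ^ dStar c N ≤ 2 * x := by
    rw [← Real.rpow_natCast]
    calc (2 : ℝ) ^ (dStar c N : ℝ) ≤ 2 ^ (Real.logb 2 x + 1) :=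
          Real.rpow_le_rpow_of_exponent_le (by norm_num) hD.le
      _ = 2 * x := by
          rw [Real.rpow_add (by norm_num), Real.rpow_logb (by norm_num) (by norm_num)
            (by linarith), Real.rpow_one, mul_comm]
  have hxN : x * 32 ≤ N := by
    calc x * 32 ≤ x * Real.log N ^ c := by gcongr
      _ = N := div_mul_cancel₀ _ hpos.ne'
  have : (2 : ℝ) ^ (dStar c N + 4) ≤ N := by
    rw [pow_add]
    linarith
  exact_mod_cast this

theorem eventually_rpow_neg_le : ∀ᶠ N : ℕ in atTop, (N : ℝ) ^ (-(1 / 9) : ℝ) ≤ 1 / 2 :=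
  ((tendsto_rpow_neg_atTop (y := 1 / 9) (by norm_num)).comp
    tendsto_natCast_atTop_atTop).eventually_le_const (by norm_num)

theorem eventually_le_logb (K : ℝ) : ∀ᶠ N : ℕ in atTop, K ≤ Real.logb 2 N :=
  ((Real.tendsto_logb_atTop (by norm_num)).comp
    tendsto_natCast_atTop_atTop).eventually_ge_atTop K

section
variable {N D : ℕ} {n : ℕ → ℕ}

/-- Beyond depth `d₁` the exact form of `φ` plays no role. The bound `1/2` prevents levels from
shrinking, and the bound `1` makes the complete binary tree admissible. The margin in `hN` leaves at
least `31 * 2 ^ j` peers beyond depth `j - 1`, so the ratio in the last case is at most `1/31`. -/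
theorem phi_mem_Icc (hN : 2 ^ (D + 4) ≤ N) (hN9 : (N : ℝ) ^ (-(1 / 9) : ℝ) ≤ 1 / 2) {j : ℕ}
    (hj : j < D) (hn : ∀ h ≤ j, n h ≤ 2 ^ h) : phi N n j ∈ Set.Icc (1 / 2 : ℝ) 1 := by
  unfold phi
  split_ifs
  · norm_num
  · exact ⟨by linarith, by linarith [Real.rpow_nonneg (Nat.cast_nonneg (α := ℝ) N) (-(1 / 9))]⟩
  have hsum : ∑ h ∈ Finset.range j, (n h : ℝ) ≤ 2 ^ j := by
    calc ∑ h ∈ Finset.range j, (n h : ℝ) ≤ ∑ h ∈ Finset.range j, (2 : ℝ) ^ h :=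
          Finset.sum_le_sum fun h hh => by exact_mod_cast hn h (Finset.mem_range.1 hh).le
      _ ≤ 2 ^ j := by
          rw [geom_sum_eq (by norm_num)]
          linarith
  have hnj : (n j : ℝ) ≤ 2 ^ j := by exact_mod_cast hn j le_rfl
  have hpow : (2 : ℝ) ^ j * 32 ≤ N := by
    have h1 : 2 ^ (j + 5) ≤ N := (Nat.pow_le_pow_right (by norm_num) (by omega)).trans hN
    have h2 : (2 : ℝ) ^ (j + 5) ≤ N := by exact_mod_cast h1
    rw [pow_add] at h2
    linarith
  have hpos : (0 : ℝ) < 2 ^ j := by positivity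
  set M : ℝ := (N : ℝ) - ∑ h ∈ Finset.range j, (n h : ℝ) with hM
  have hM0 : 2 ^ j * 31 ≤ M := by linarith
  have hr0 : 0 ≤ (n j : ℝ) / M := div_nonneg (Nat.cast_nonneg _) (by linarith)
  have hr1 : (n j : ℝ) / M ≤ 1 / 31 := by
    rw [div_le_div_iff₀ (by linarith) (by norm_num)]
    linarith
  set r : ℝ := (n j : ℝ) / M with hr
  constructor
  · calc (1 / 2 : ℝ) ≤ (1 - 1 / 31) ^ 3 := by norm_num
      _ ≤ (1 - r) ^ 3 := pow_le_pow_left₀ (by norm_num) (by linarith) 3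
  · exact pow_le_one₀ (by linarith) (by linarith)

theorem NearBinary.two_mul_le {c : ℝ} (h : NearBinary c N n) {d : ℕ} (hd : d < dStar c N)
    (hd1 : d < dOne N) : 2 * n d ≤ n (d + 1) := by
  have := h (d + 1) (by omega) hd
  rw [Nat.add_sub_cancel, phi, if_pos hd1, mul_one] at this
  exact_mod_cast this

theorem rpow_le_two_pow_dOne (hN : 1 ≤ N) : (N : ℝ) ^ (1 / 3 : ℝ) ≤ 2 ^ dOne N := by
  have hN0 : (0 : ℝ) < N := by exact_mod_cast hN
  calc (N : ℝ) ^ (1 / 3 : ℝ) = 2 ^ (Real.logb 2 N / 3) := by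
        rw [div_eq_mul_one_div (Real.logb 2 N), Real.rpow_mul (by norm_num),
          Real.rpow_logb (by norm_num) (by norm_num) hN0]
    _ ≤ 2 ^ (dOne N : ℝ) := Real.rpow_le_rpow_of_exponent_le (by norm_num) (Nat.le_ceil _)
    _ = 2 ^ dOne N := Real.rpow_natCast _ _

/-- Exact doubling while `φ = 1` brings level `d₁` to `2 ^ d₁ ≥ N^{1/3}`, and `φ ≥ 1/2` makes later
levels at least as large. -/
theorem NearBinary.rpow_le {c : ℝ} (h : NearBinary c N n) (hN : 2 ^ (dStar c N + 4) ≤ N)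
    (hN9 : (N : ℝ) ^ (-(1 / 9) : ℝ) ≤ 1 / 2) (hn0 : n 0 = 1)
    (hn : ∀ d, n d ≤ 2 ^ d) {d : ℕ} (hd : d ≤ dStar c N) (hd1 : dOne N ≤ d) :
    (N : ℝ) ^ (1 / 3 : ℝ) ≤ n d := by
  have hN1 : 1 ≤ N := Nat.one_le_two_pow.trans hN
  have hbin : ∀ k ≤ dOne N, k ≤ dStar c N → 2 ^ k ≤ n k := by
    intro k
    induction k with
    | zero => intro _ _; rw [hn0, pow_zero]
    | succ k ih =>
      intro hk hk'
      have h1 := ih (by omega) (by omega)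
      have h2 := h.two_mul_le (d := k) (by omega) (by omega)
      rw [pow_succ]
      omega
  have hmono : ∀ k, dOne N ≤ k → k ≤ dStar c N → n (dOne N) ≤ n k := by
    intro k hk
    induction k, hk using Nat.le_induction with
    | base => intro _; exact le_rfl
    | succ k hk ih =>
      intro hkD
      refine (ih (by omega)).trans ?_
      have h1 := h (k + 1) (by omega) hkD
      rw [Nat.add_sub_cancel] at h1
      have h2 := (phi_mem_Icc hN hN9 (n := n) (j := k) (by omega) fun h _ => hn h).1
      have h3 : (n k : ℝ) ≤ n (k + 1) := by nlinarith [Nat.cast_nonneg (α := ℝ) (n k)]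
      exact_mod_cast h3
  have : 2 ^ dOne N ≤ n d := (hbin _ le_rfl (hd1.trans hd)).trans (hmono d hd1 hd)
  exact (rpow_le_two_pow_dOne hN1).trans (by exact_mod_cast this)

/-- A prescribed realization fixes the level sizes only up to `d*`; the inequalities look no
further. -/
theorem NearBinary.congr {c : ℝ} (h : NearBinary c N n) {n' : ℕ → ℕ}
    (hn : ∀ d ≤ dStar c N, n' d = n d) : NearBinary c N n' := by
  intro d hd hdD
  have hphi : phi N n' (d - 1) = phi N n (d - 1) := by
    unfold phi
    rw [hn (d - 1) (by omega), Finset.sum_congr rfl fun k hk => by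
      rw [hn k (by have := Finset.mem_range.1 hk; omega)]]
  rw [hphi, hn d hdD, hn (d - 1) (by omega)]
  exact h d hd hdD

theorem nearBinary_of_eq_two_pow {c : ℝ} (hN : 2 ^ (dStar c N + 4) ≤ N)
    (hN9 : (N : ℝ) ^ (-(1 / 9) : ℝ) ≤ 1 / 2) (hn : ∀ d ≤ dStar c N, n d = 2 ^ d) :
    NearBinary c N n := by
  intro d hd hdD
  obtain ⟨k, rfl⟩ : ∃ k, d = k + 1 := ⟨d - 1, by omega⟩
  rw [Nat.add_sub_cancel, hn k (by omega), hn (k + 1) hdD]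
  have := (phi_mem_Icc hN hN9 (n := n) (j := k) (by omega)
    fun h hh => (hn h (by omega)).le).2
  push_cast
  rw [pow_succ]
  have hpos : (0 : ℝ) < 2 ^ k := by positivity
  nlinarith

end

/-! ### Accumulation of the deviations over all depths. -/

theorem dStar_le_logb {c : ℝ} {N : ℕ} (hN : 2 ^ (dStar c N + 4) ≤ N) :
    (dStar c N : ℝ) ≤ Real.logb 2 N := by
  have h0 : (0 : ℝ) < N := by exact_mod_cast Nat.one_le_two_pow.trans hN
  rw [Real.le_logb_iff_rpow_le (by norm_num) h0, Real.rpow_natCast]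
  exact_mod_cast (Nat.pow_le_pow_right (by norm_num) (by omega)).trans hN

/-- Depth `1` is exactly balanced, doubling steps change nothing, and each later step costs at most
`δ`. -/
theorem abs_flowOne_ratio_sub_half_le {c δ : ℝ} {V : Finset ℕ} {ω : Outcome} (hδ : 0 ≤ δ)
    (hV : source ∈ V) (hω : ω ∈ outcomesOn V) (hD : 1 ≤ dStar c V.card)
    (hd1 : 1 ≤ dOne V.card)
    (hn : NearBinary c V.card (levelCount V (dStar c V.card) ω))
    (hdev : ∀ d, 1 ≤ d → d < dStar c V.card → dOne V.card ≤ d →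
      |(flowOneCount V (dStar c V.card) ω (d + 1) : ℝ) / levelCount V (dStar c V.card) ω (d + 1) -
        (flowOneCount V (dStar c V.card) ω d : ℝ) / levelCount V (dStar c V.card) ω d| ≤ δ)
    {d : ℕ} (hd : d < dStar c V.card) :
    |(flowOneCount V (dStar c V.card) ω (d + 1) : ℝ) / levelCount V (dStar c V.card) ω (d + 1) -
      1 / 2| ≤ d * δ := by
  induction d with
  | zero =>
    have h1 := hn.two_mul_le (d := 0) (by omega) (by omega)
    rw [levelCount_zero hD hV, zero_add, mul_one] at h1
    have h2 := levelCount_le_two_pow hD hV hω 1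
    have h3 : levelCount V (dStar c V.card) ω 1 = 2 := by omega
    rw [zero_add, flowOneCount_one hD hV hω h1, h3]
    norm_num
  | succ d ih =>
    have ih' := ih (by omega)
    have hstep : |(flowOneCount V (dStar c V.card) ω (d + 1 + 1) : ℝ) /
        levelCount V (dStar c V.card) ω (d + 1 + 1) -
        (flowOneCount V (dStar c V.card) ω (d + 1) : ℝ) /
          levelCount V (dStar c V.card) ω (d + 1)| ≤ δ := by
      rcases Nat.lt_or_ge (d + 1) (dOne V.card) with h | h
      · have h1 := hn.two_mul_le hd h
        have h2 := levelCount_succ_le (d := d + 1) hD hω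
        rw [flowOneCount_succ_of_full hD (by omega) hω h1, le_antisymm h2 h1]
        push_cast
        rw [mul_div_mul_left _ _ (by norm_num), sub_self, abs_zero]
        exact hδ
      · exact hdev (d + 1) (by omega) hd h
    have := abs_sub_le ((flowOneCount V (dStar c V.card) ω (d + 1 + 1) : ℝ) /
      levelCount V (dStar c V.card) ω (d + 1 + 1)) ((flowOneCount V (dStar c V.card) ω (d + 1) : ℝ) /
          levelCount V (dStar c V.card) ω (d + 1)) (1 / 2)
    push_cast
    linarith

/-- Since `ε L ≥ 1`, one has `ε² / L² = (ε L)² / L⁴ ≥ (1 - ε) / L⁴`, which turns the Chernoff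
exponent into the required one. -/
theorem exp_neg_le_of_inv_le {ε L x : ℝ} (hε : 0 < ε) (hx : 0 ≤ x) (hL : 1 / ε ≤ L) :
    Real.exp (-(x * (ε / L) ^ 2 / 4)) ≤ (Real.exp ((1 - ε) * x / (4 * L ^ 4)))⁻¹ := by
  have hL0 : 0 < L := (by positivity : 0 < 1 / ε).trans_le hL
  have h1 : 1 ≤ ε * L := by rwa [div_le_iff₀' hε] at hL
  rw [← Real.exp_neg, Real.exp_le_exp, neg_le_neg_iff, div_pow]
  have e : x * (ε ^ 2 / L ^ 2) / 4 = (ε * L) ^ 2 * x / (4 * L ^ 4) := by field_simp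
  rw [e]
  gcongr
  nlinarith

open Classical in
/-- The counting form of the concentration bound, for a set of outcomes that is determined by the
numbers of peers in each depth. -/
theorem card_not_balanced_le {c ε : ℝ} (hε : 0 < ε) {V : Finset ℕ} (hV : source ∈ V)
    (hD : 1 ≤ dStar c V.card) (hN : 2 ^ (dStar c V.card + 4) ≤ V.card)
    (hN9 : (V.card : ℝ) ^ (-(1 / 9) : ℝ) ≤ 1 / 2) (hL : 1 / ε ≤ Real.logb 2 V.card)
    (hLε : ε ≤ Real.logb 2 V.card) (P : (ℕ → ℕ) → Prop)
    (hP : ∀ ω ∈ outcomesOn V, P (levelCount V (dStar c V.card) ω) →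
      NearBinary c V.card (levelCount V (dStar c V.card) ω)) :
    (({ω ∈ outcomesOn V | P (levelCount V (dStar c V.card) ω) ∧ ¬ Balanced c ε V ω} :
        Finset Outcome).card : ℝ) ≤
      2 * Real.logb 2 V.card / Real.exp ((1 - ε) * (V.card : ℝ) ^ (1 / 3 : ℝ) /
        (4 * Real.logb 2 V.card ^ 4)) *
      ({ω ∈ outcomesOn V | P (levelCount V (dStar c V.card) ω)} : Finset Outcome).card := by
  set D := dStar c V.card with hDdef
  set L := Real.logb 2 V.card with hLdef
  set θ : ℝ := (V.card : ℝ) ^ (1 / 3 : ℝ) with hθdef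
  set δ : ℝ := ε / L with hδdef
  set E : Finset Outcome := {ω ∈ outcomesOn V | P (levelCount V D ω)} with hE
  have hL0 : 0 < L := hε.trans_le hLε
  have hDL : (D : ℝ) ≤ L := dStar_le_logb hN
  have hδ0 : 0 < δ := by positivity
  have hδ1 : δ ≤ 1 := div_le_one_of_le₀ hLε hL0.le
  have hN1 : 1 ≤ V.card := Nat.one_le_two_pow.trans hN
  have hθ0 : 0 < θ := Real.rpow_pos_of_pos (by exact_mod_cast hN1) _
  have hd1 : 1 ≤ dOne V.card := Nat.ceil_pos.2 (by positivity)
  have hEsub : E ⊆ outcomesOn V := Finset.filter_subset _ _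
  have hEnear : ∀ ω ∈ E, NearBinary c V.card (levelCount V D ω) := fun ω hω =>
    hP ω (Finset.mem_filter.1 hω).1 (Finset.mem_filter.1 hω).2
  set B : ℕ → Finset Outcome := fun d => {ω ∈ E | δ < |(flowOneCount V D ω (d + 1) : ℝ) /
    levelCount V D ω (d + 1) - (flowOneCount V D ω d : ℝ) / levelCount V D ω d|} with hB
  have hBcard : ∀ d ∈ {d ∈ Finset.Ico 1 D | dOne V.card ≤ d},
      ((B d).card : ℝ) ≤ 2 * Real.exp (-(θ * δ ^ 2 / 4)) * E.card := by
    intro d hd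
    rw [Finset.mem_filter, Finset.mem_Ico] at hd
    refine card_flowOne_deviation_le hD hd.1.1 hEsub ?_ hδ0.le (by linarith) hθ0 ?_
    -- Membership in `E` depends on the level sizes alone, which permuting parents preserves; this
    -- is why conditioning does not disturb the symmetry.
    · intro ω hω σ hσ
      obtain ⟨h1, h2⟩ := Finset.mem_filter.1 hω
      refine Finset.mem_filter.2 ⟨permuteParents_mem_outcomesOn hσ h1, ?_⟩
      rwa [levelCount_permuteParents hD hσ]
    · intro ω hω
      exact (hEnear ω hω).rpow_le hN hN9 (levelCount_zero hD hV)
        (levelCount_le_two_pow hD hV (hEsub hω)) (by omega) (by omega)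
  -- If no single step exceeds `δ = ε / L`, the total drift up to `d*` is below `L δ = ε`, because
  -- `d* ≤ L`.
  have hsub : ({ω ∈ outcomesOn V | P (levelCount V D ω) ∧ ¬ Balanced c ε V ω} :
      Finset Outcome) ⊆ ({d ∈ Finset.Ico 1 D | dOne V.card ≤ d} : Finset ℕ).biUnion B := by
    intro ω hω
    obtain ⟨hωV, hωP, hbal⟩ := Finset.mem_filter.1 hω
    have hωE : ω ∈ E := Finset.mem_filter.2 ⟨hωV, hωP⟩
    by_contra hnot
    refine hbal fun d hd hdD => ?_
    obtain ⟨k, rfl⟩ : ∃ k, d = k + 1 := ⟨d - 1, by omega⟩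
    have hkD : k < D := hdD
    refine (abs_flowOne_ratio_sub_half_le hδ0.le hV hωV hD hd1 (hEnear ω hωE) ?_
      hdD).trans_lt ?_
    · intro j hj hjD hj1
      by_contra hlt
      exact hnot (Finset.mem_biUnion.2 ⟨j, Finset.mem_filter.2 ⟨Finset.mem_Ico.2 ⟨hj, hjD⟩, hj1⟩,
        Finset.mem_filter.2 ⟨hωE, not_le.1 hlt⟩⟩)
    · have hk : (k : ℝ) < L := (by exact_mod_cast hkD : (k : ℝ) < D).trans_le hDL
      calc k * δ < L * δ := by gcongr
        _ = ε := mul_div_cancel₀ _ hL0.ne'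
  calc _ ≤ ∑ d ∈ Finset.Ico 1 D with dOne V.card ≤ d, ((B d).card : ℝ) := by
        exact_mod_cast (Finset.card_le_card hsub).trans Finset.card_biUnion_le
    _ ≤ ∑ d ∈ Finset.Ico 1 D with dOne V.card ≤ d,
          2 * Real.exp (-(θ * δ ^ 2 / 4)) * E.card := Finset.sum_le_sum hBcard
    _ ≤ L * (2 * Real.exp (-(θ * δ ^ 2 / 4)) * E.card) := by
        rw [Finset.sum_const, nsmul_eq_mul]
        gcongr
        refine le_trans ?_ hDL
        have := Finset.card_filter_le (Finset.Ico 1 D) (dOne V.card ≤ ·)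
        rw [Nat.card_Ico] at this
        exact_mod_cast this.trans (Nat.sub_le _ _)
    _ ≤ L * (2 * (Real.exp ((1 - ε) * θ / (4 * L ^ 4)))⁻¹ * E.card) := by
        gcongr
        exact exp_neg_le_of_inv_le hε hθ0.le hL
    _ = _ := by
        rw [div_eq_mul_inv]
        ring

end P2P

theorem proposition4 (c : ℝ) (hc0 : 0 < c) (hc1 : c < 1) (ε : ℝ) (hε : 0 < ε) :
    ∃ N₀ : ℕ, ∀ (V : Finset ℕ) (μ : PMF P2P.Layers), P2P.PairingLaw V μ → N₀ ≤ V.card →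
      (0 < (P2P.outcomeLaw V μ).toMeasure
          {ω | P2P.NearBinary c V.card (P2P.levelCount V (P2P.dStar c V.card) ω)} ∧
        P2P.lowerBound ε V.card ≤
          (ProbabilityTheory.cond (P2P.outcomeLaw V μ).toMeasure
            {ω | P2P.NearBinary c V.card (P2P.levelCount V (P2P.dStar c V.card) ω)}).real
            {ω | P2P.Balanced c ε V ω}) ∧
      ∀ n : ℕ → ℕ, P2P.NearBinary c V.card n →
        0 < (P2P.outcomeLaw V μ).toMeasure
          {ω | ∀ d ≤ P2P.dStar c V.card, P2P.levelCount V (P2P.dStar c V.card) ω d = n d} →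
        P2P.lowerBound ε V.card ≤
          (ProbabilityTheory.cond (P2P.outcomeLaw V μ).toMeasure
            {ω | ∀ d ≤ P2P.dStar c V.card,
              P2P.levelCount V (P2P.dStar c V.card) ω d = n d}).real
            {ω | P2P.Balanced c ε V ω} := by
  classical
  obtain ⟨N₀, hN₀⟩ := Filter.eventually_atTop.1 ((P2P.eventually_dStar hc0 hc1).and
    (P2P.eventually_rpow_neg_le.and
      ((P2P.eventually_le_logb (1 / ε)).and (P2P.eventually_le_logb ε))))
  refine ⟨N₀, fun V μ hμ hVN => ?_⟩
  obtain ⟨⟨hD, hN⟩, hN9, hL, hLε⟩ := hN₀ V.card hVN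
  have hV := hμ.eq_uniform.1
  have hpos : 0 < (P2P.outcomeLaw V μ).toMeasure
      {ω | P2P.NearBinary c V.card (P2P.levelCount V (P2P.dStar c V.card) ω)} := by
    rw [P2P.outcomeLaw_pos_iff hμ]
    obtain ⟨ω, hω, hlevel⟩ := P2P.exists_levelCount_eq_two_pow hD hV
      ((Nat.pow_le_pow_right (by norm_num) (by omega)).trans hN)
    exact ⟨ω, Finset.mem_filter.2 ⟨hω, P2P.nearBinary_of_eq_two_pow hN hN9 hlevel⟩⟩
  refine ⟨⟨hpos, ?_⟩, fun n hn hnpos => ?_⟩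
  -- Both conditionings are events determined by the level sizes: first the inequalities themselves,
  -- then one realization that satisfies them.
  · exact P2P.cond_outcomeLaw_ge hμ ((P2P.outcomeLaw_pos_iff hμ).1 hpos)
      (P2P.card_not_balanced_le hε hV hD hN hN9 hL hLε (P2P.NearBinary c V.card)
        fun _ _ h => h)
  · exact P2P.cond_outcomeLaw_ge hμ ((P2P.outcomeLaw_pos_iff hμ).1 hnpos)
      (P2P.card_not_balanced_le hε hV hD hN hN9 hL hLε
        (fun f => ∀ d ≤ P2P.dStar c V.card, f d = n d) fun _ _ h => hn.congr h)
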